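/- Let $k$ be a field, $F=k((t))$ with its $t$-adic valuation $v$, and let $D$ be a division algebra with center $F$, finite dimensional over $F$, of characteristic $p>0$. Let $w$ be the unique extension of $v$ to $D$, normalized to have value group $\mathbb Z$; write $V_D$ for the valuation ring and $\bar D$, $\bar F$ for the residue rings. A *parameter* of $D$ is an element $z\in D^\times$ such that $w(z)$ generates the value group of $D$. $D$ is *splittable* if there is a ring homomorphism $u:\bar D\to V_D$ that is a section of the residue map $V_D\to\bar D$ (an *embedding*), and *good splittable* if there is such a $u$ whose restriction to $\bar F$ is a section $\bar F\to F$ of the residue map of $F$. For a parameter $z$ let $\alpha_z$ be the automorphism of $\bar D$ induced by conjugation $x\mapsto zxz^{-1}$; if $\alpha_z=\mathrm{id}$ and $u$ is an embedding, the *local height* is $i(u,z)=\min_{a\in\bar D} w\bigl(z\,u(a)\,z^{-1}-u(a)\bigr)$. A subfield $F\subseteq L\subseteq D$ is called *"unramified"* if $[\bar L:\bar F]=[L:F]$ (the residue extension may be inseparable). Assume that $\bar D$ is commutative and that $[\bar D:\bar F]=p$. Then: 1. $D$ is splittable. 2. There is a natural number $i$ such that $i(u,z)=i$ for every embedding $u$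 and every parameter $z$ with $\alpha_z=\mathrm{id}$; that is, the local height, where it is defined, is finite and does not depend on $u$ and $z$. 3. Suppose the local height $i$ is defined (there is a parameter $z$ with $\alpha_z=\mathrm{id}$). If $\gcd(i,p)=1$, then $D$ is good splittable. If $p\mid i$, then there is a parameter $z'$ of $D$ with $z'^p\in F$, and every "unramified" maximal subfield of $D$ is a cyclic Galois extension of $F$. 4. In all cases $D$ is a cyclic algebra of degree $p$ over $F$, i.e. $D=\bigoplus_{j=0}^{p-1}Lx^j$ for a cyclic Galois extension $L/F$ of degree $p$ inside $D$ with $\mathrm{Gal}(L/F)=\langle\sigma\rangle$ and an element $x$ with $x\,l=\sigma(l)\,x$ for $l\in L$ and $x^p\in F^\times$. -/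

import Mathlib

open scoped LaurentSeries WithZero

noncomputable section

namespace ValuedDivision

universe u

section Residue

variable {R : Type*} [Ring R] {Γ : Type*} [LinearOrderedCommGroupWithZero Γ]

/-- The ideal `M = {x | w x < 1}` of the valuation ring `V = {x | w x ≤ 1}`. -/
def maxIdeal (w : Valuation R Γ) : Ideal w.integer where
  carrier := {x | w (x : R) < 1}
  zero_mem' := by simp
  add_mem' {a b} ha hb := w.map_add_lt ha hb
  smul_mem' c {x} hx := by
    have h : w ((c : R) * (x : R)) < 1 := by
      rw [map_mul]
      exact (mul_le_of_le_one_left' c.2).trans_lt hx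
    exact h

instance maxIdeal_isTwoSided (w : Valuation R Γ) : (maxIdeal w).IsTwoSided where
  mul_mem_of_left {a} b ha := by
    have h : w ((a : R) * (b : R)) < 1 := by
      rw [map_mul]
      exact (mul_le_of_le_one_right' b.2).trans_lt ha
    exact h

/-- The residue ring `V / M` of a valuation. -/
abbrev ResidueRing (w : Valuation R Γ) : Type _ := w.integer ⧸ maxIdeal w

/-- The residue homomorphism `V → V / M`. -/
abbrev residue (w : Valuation R Γ) : w.integer →+* ResidueRing w :=
  Ideal.Quotient.mk (maxIdeal w)

/-- A ring homomorphism `V / M → V` that is a section of the residue homomorphism. -/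
def IsSection (w : Valuation R Γ) (s : ResidueRing w →+* w.integer) : Prop :=
  ∀ a, residue w (s a) = a

end Residue

section Extension

variable {F : Type*} [Field F] {Γ Γ' : Type*} [LinearOrderedCommGroupWithZero Γ]
  [LinearOrderedCommGroupWithZero Γ'] (v : Valuation F Γ)

/-- The map of residue rings induced by an extension of valuations. -/
def residueMap {A : Type*} [Ring A] [Algebra F A] (w : Valuation A Γ') [v.HasExtension w] :
    ResidueRing v →+* ResidueRing w :=
  Ideal.Quotient.lift (maxIdeal v) ((residue w).comp (algebraMap v.integer w.integer)) (by
    intro a ha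
    refine Ideal.Quotient.eq_zero_iff_mem.mpr ?_
    exact (Valuation.HasExtension.val_map_lt_one_iff v w (a : F)).mpr ha)

/-- The degree `[Ā : F̄]` of the residue extension. -/
def residueDegree {A : Type*} [Ring A] [Algebra F A] (w : Valuation A Γ') [v.HasExtension w] : ℕ :=
  letI : Module (ResidueRing v) (ResidueRing w) := Module.compHom _ (residueMap v w)
  Module.finrank (ResidueRing v) (ResidueRing w)

/-- The restriction of `w` along an embedding of `F`-algebras still extends `v`. -/
instance hasExtension_comap {L D : Type*} [Ring L] [Ring D] [Algebra F L] [Algebra F D]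
    (w : Valuation D Γ') [h : v.HasExtension w] (f : L →ₐ[F] D) :
    v.HasExtension (w.comap (f : L →+* D)) where
  val_isEquiv_comap := by
    have e : (w.comap (f : L →+* D)).comap (algebraMap F L) = w.comap (algebraMap F D) := by
      ext x
      simp
    rw [e]
    exact h.val_isEquiv_comap

end Extension

section Division

variable {D : Type u} [DivisionRing D]

/-- `D` is splittable: the residue homomorphism has a section. -/
def IsSplittable (w : Valuation D ℤᵐ⁰) : Prop :=
  ∃ s : ResidueRing w →+* w.integer, IsSection w s

/-- `D` is good splittable over its center `F`: there is a section of the residue homomorphism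
of `D` which restricts to a section of the residue homomorphism of `F`. -/
def IsGoodSplittable {F : Type*} [Field F] [Algebra F D] (v : Valuation F ℤᵐ⁰)
    (w : Valuation D ℤᵐ⁰) [v.HasExtension w] : Prop :=
  ∃ (s : ResidueRing w →+* w.integer) (i : ResidueRing v →+* v.integer),
    IsSection w s ∧ IsSection v i ∧
      ∀ a, (s (residueMap v w a) : D) = algebraMap F D (i a : F)

/-- A parameter of `D`: an element whose value generates the value group. -/
def IsParameter (w : Valuation D ℤᵐ⁰) (z : D) : Prop :=
  z ≠ 0 ∧ ∀ y : D, y ≠ 0 → ∃ n : ℤ, w y = w z ^ n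

/-- Conjugation by `z` on the valuation ring. -/
def conjInteger (w : Valuation D ℤᵐ⁰) (z : D) (a : w.integer) : w.integer :=
  ⟨z * a * z⁻¹, by
    rw [Valuation.mem_integer_iff, map_mul, map_mul, map_inv₀, mul_right_comm]
    exact mul_le_one' mul_inv_le_one a.2⟩

/-- The automorphism `α` of the residue ring induced by conjugation by `z` is the identity. -/
def ConjTrivial (w : Valuation D ℤᵐ⁰) (z : D) : Prop :=
  ∀ a : w.integer, residue w (conjInteger w z a) = residue w a

/-- `i` is the local height `min_a w(z u(a) z⁻¹ - u(a))`, where `a` runs over the residue ring.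
The valuation is written multiplicatively, so the additive value `i` is `exp (-i)` and the
minimum is a maximum. -/
def IsLocalHeight (w : Valuation D ℤᵐ⁰) (u : ResidueRing w →+* w.integer) (z : D) (i : ℕ) :
    Prop :=
  IsGreatest (Set.range fun a : ResidueRing w => w (z * (u a : D) * z⁻¹ - (u a : D)))
    (WithZero.exp (-(i : ℤ)))

end Division

section Subfields

variable (F : Type*) [Field F] {D : Type u} [DivisionRing D] [Algebra F D]

/-- The image of `f : L → D` is a maximal subfield of `D` (the commutative subalgebras of a finite
dimensional division algebra are exactly the subfields that contain `F`). -/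
def IsMaximalSubfield {L : Type u} [Field L] [Algebra F L] (f : L →ₐ[F] D) : Prop :=
  ∀ S : Subalgebra F D, (∀ x ∈ S, ∀ y ∈ S, x * y = y * x) → f.range ≤ S → S = f.range

/-- The field `L` with the restricted valuation satisfies `[L̄ : F̄] = [L : F]`; the residue
extension may be inseparable. -/
def IsUnramifiedSubfield (v : Valuation F ℤᵐ⁰) (w : Valuation D ℤᵐ⁰) [v.HasExtension w]
    {L : Type u} [Field L] [Algebra F L] (f : L →ₐ[F] D) : Prop :=
  residueDegree v (w.comap (f : L →+* D)) = Module.finrank F L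

/-- `L / F` is a finite Galois extension with cyclic group. -/
def IsCyclicGalois (L : Type u) [Field L] [Algebra F L] : Prop :=
  FiniteDimensional F L ∧ IsGalois F L ∧ IsCyclic (L ≃ₐ[F] L)

/-- `D` is a cyclic algebra `(L/F, σ, a)` of degree `n`: it contains a Galois extension `L` of
`F` of degree `n` with group generated by `σ`, and an element `x` with `x ^ n = a ∈ Fˣ` and
`x l = σ(l) x` for `l ∈ L`, such that `1, x, …, x ^ (n - 1)` is a basis of `D` over `L`. -/
def IsCyclicAlgebra (D : Type u) [DivisionRing D] [Algebra F D] (n : ℕ) : Prop :=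
  ∃ (L : Type u) (_ : Field L) (_ : Algebra F L) (f : L →ₐ[F] D) (σ : L ≃ₐ[F] L) (x : D) (a : F),
    FiniteDimensional F L ∧ IsGalois F L ∧ Module.finrank F L = n ∧
    (∀ τ : L ≃ₐ[F] L, τ ∈ Subgroup.zpowers σ) ∧
    a ≠ 0 ∧ x ^ n = algebraMap F D a ∧ (∀ l : L, x * f l = f (σ l) * x) ∧
    Function.Bijective fun c : Fin n → L => ∑ j : Fin n, f (c j) * x ^ (j : ℕ)

end Subfields

end ValuedDivision

end

/-! Everything is controlled by one integer, the level `i`: the largest integer with ord[a,b] ≥ ord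
a + ord b + i for all a, b. Write Z(x) for the centralizer of an integral x whose residue lies
outside F̄; such a residue generates D̄, because [D̄:F̄] = p is prime.

Numerics. Products of powers of x and of a uniformizer z, with coefficients in F, form an F-basis of
D, so D is complete and [D:F] = pe with e the ramification index. The subfields F(x) and F(z) have
degree at least p and e, while a subfield has degree at most the square root of [D:F]; hence e = p
and [D:F] = p² (`IsPowBasis.ramification_eq`).

Commutators. The level is attained by every pair of a uniformizer and an x as above, and by Bezout
[d,x] has order exactly n + i whenever d has order n prime to p (`IsPrimeRamified.ordEq_lie`). So
Z(x) has only orders divisible by p, it is commutative, and the commutator with x maps the graded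
piece of degree n prime to p onto that of degree n + i. Since zu(a)z⁻¹ - u(a) = [z,u(a)]z⁻¹, the
local height is the level.

If p divides i (this includes i = 0, where conjugation acts nontrivially on D̄), each graded error
in making zxz⁻¹ commute with x is removed either inside Z(x) or by changing z. In the limit a
uniformizer normalizes the field Z(x) without centralizing it, which makes Z(x) cyclic over F and D
a cyclic algebra (`IsPrimeRamified.exists_normalizer`, `cyclic_of_normalizes`).

If p does not divide i, then ad(x)^p = ad(x^p) makes x^p nearly central, and Jacobson's formula for
ad(x+q)^p allows x to be corrected until x^p lies in F (`IsPrimeRamified.exists_pow_central`). Then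
ad(x) is nilpotent and nonzero, which yields s with xsx⁻¹ = s + 1; so F(s) is normalized by x and D
is again cyclic.

Splitting. The ring of integers of Z(x) is commutative and complete with residue field D̄. If D̄/F̄
is separable, Hensel's lemma lifts x̄. If x̄^p = c lies in F̄, the coefficient field F̄ is first
deformed so that c is sent to x^p (`exists_ringHom_apply_eq`), and then x̄ can be sent to x. When
x^p lies in F, the deformation takes place inside the valuation ring of F, so D is good splittable.
-/

namespace ValuedDivision

/-! ### Additive orders and successive approximation. -/

section Order

variable {D : Type*} [DivisionRing D] {w : Valuation D ℤᵐ⁰}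

/-- The additive value of `x` is at least `n`. -/
def OrdGE (w : Valuation D ℤᵐ⁰) (n : ℤ) (x : D) : Prop := w x ≤ WithZero.exp (-n)

/-- The additive value of `x` is equal to `n`. -/
def OrdEq (w : Valuation D ℤᵐ⁰) (n : ℤ) (x : D) : Prop := w x = WithZero.exp (-n)

lemma OrdEq.ge {n : ℤ} {x : D} (h : OrdEq w n x) : OrdGE w n x := le_of_eq h

lemma OrdGE.mono {m n : ℤ} {x : D} (h : OrdGE w n x) (hm : m ≤ n) : OrdGE w m x :=
  le_trans h (by simpa only [WithZero.exp_le_exp, neg_le_neg_iff] using hm)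

lemma ordGE_zero (n : ℤ) : OrdGE w n 0 := by simp [OrdGE]

lemma OrdGE.add {n : ℤ} {x y : D} (hx : OrdGE w n x) (hy : OrdGE w n y) : OrdGE w n (x + y) :=
  w.map_add_le hx hy

lemma OrdGE.sub {n : ℤ} {x y : D} (hx : OrdGE w n x) (hy : OrdGE w n y) : OrdGE w n (x - y) :=
  w.map_sub_le hx hy

lemma OrdGE.neg {n : ℤ} {x : D} (hx : OrdGE w n x) : OrdGE w n (-x) := by
  simpa only [OrdGE, Valuation.map_neg] using hx

lemma OrdGE.sub_symm {n : ℤ} {x y : D} (h : OrdGE w n (x - y)) : OrdGE w n (y - x) := by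
  simpa only [neg_sub] using h.neg

lemma OrdGE.sum {ι : Type*} {s : Finset ι} {f : ι → D} {n : ℤ} (h : ∀ i ∈ s, OrdGE w n (f i)) :
    OrdGE w n (∑ i ∈ s, f i) := w.map_sum_le h

lemma OrdGE.mul {m n : ℤ} {x y : D} (hx : OrdGE w m x) (hy : OrdGE w n y) :
    OrdGE w (m + n) (x * y) := by
  unfold OrdGE at *
  rw [map_mul, neg_add, WithZero.exp_add]
  exact mul_le_mul' hx hy

lemma OrdEq.mul {m n : ℤ} {x y : D} (hx : OrdEq w m x) (hy : OrdEq w n y) :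
    OrdEq w (m + n) (x * y) := by
  unfold OrdEq at *
  rw [map_mul, neg_add, WithZero.exp_add, hx, hy]

lemma OrdEq.neg {n : ℤ} {x : D} (hx : OrdEq w n x) : OrdEq w n (-x) := by
  simpa only [OrdEq, Valuation.map_neg] using hx

lemma OrdEq.inv {n : ℤ} {x : D} (hx : OrdEq w n x) : OrdEq w (-n) x⁻¹ := by
  unfold OrdEq at *
  rw [map_inv₀, hx, ← WithZero.exp_neg]

lemma OrdEq.pow {n : ℤ} {x : D} (hx : OrdEq w n x) (m : ℕ) : OrdEq w (m * n) (x ^ m) := by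
  unfold OrdEq at *
  rw [map_pow, hx, ← WithZero.exp_nsmul]
  simp

lemma OrdEq.zpow {n : ℤ} {x : D} (hx : OrdEq w n x) (m : ℤ) : OrdEq w (m * n) (x ^ m) := by
  unfold OrdEq at *
  rw [map_zpow₀, hx, ← WithZero.exp_zsmul]
  simp

lemma OrdGE.pow {n : ℤ} {x : D} (hx : OrdGE w n x) (m : ℕ) : OrdGE w (m * n) (x ^ m) := by
  induction m with
  | zero => simp [OrdGE]
  | succ m ih =>
    rw [pow_succ]
    exact (ih.mul hx).mono (by push_cast; linarith)

lemma ordEq_one : OrdEq w 0 (1 : D) := by simp [OrdEq]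

lemma OrdEq.ne_zero {n : ℤ} {x : D} (hx : OrdEq w n x) : x ≠ 0 := by
  rintro rfl
  simp only [OrdEq, map_zero] at hx
  exact WithZero.exp_ne_zero hx.symm

lemma OrdEq.le {m n : ℤ} {x : D} (hx : OrdEq w n x) (h : OrdGE w m x) : m ≤ n := by
  unfold OrdEq OrdGE at *
  rw [hx, WithZero.exp_le_exp] at h
  omega

lemma OrdEq.unique {m n : ℤ} {x : D} (hx : OrdEq w n x) (h : OrdEq w m x) : m = n :=
  le_antisymm (hx.le h.ge) (h.le hx.ge)

lemma exists_ordEq {x : D} (hx : x ≠ 0) : ∃ n, OrdEq w n x := by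
  refine ⟨-WithZero.log (w x), ?_⟩
  unfold OrdEq
  rw [neg_neg, WithZero.exp_log ((w.ne_zero_iff).2 hx)]

lemma ordEq_or_ordGE {n : ℤ} {x : D} (h : OrdGE w n x) : OrdEq w n x ∨ OrdGE w (n + 1) x := by
  rcases eq_or_ne x 0 with rfl | hx
  · exact Or.inr (ordGE_zero _)
  · obtain ⟨m, hm⟩ := exists_ordEq (w := w) hx
    have := hm.le h
    rcases eq_or_lt_of_le this with rfl | h'
    · exact Or.inl hm
    · exact Or.inr (hm.ge.mono h')

lemma not_ordGE_succ {n : ℤ} {x : D} (h : OrdEq w n x) : ¬ OrdGE w (n + 1) x := fun h' => by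
  have := h.le h'
  omega

lemma OrdEq.of_sub {n : ℤ} {x y : D} (hx : OrdEq w n x) (h : OrdGE w (n + 1) (y - x)) :
    OrdEq w n y := by
  have h1 : OrdGE w n y := by
    simpa using (h.mono (by omega)).add hx.ge
  refine (ordEq_or_ordGE h1).resolve_right fun h2 => not_ordGE_succ hx ?_
  simpa using h2.sub h

lemma eq_zero_of_forall_ordGE {x : D} (h : ∀ n : ℕ, OrdGE w n x) : x = 0 := by
  by_contra hx
  obtain ⟨m, hm⟩ := exists_ordEq (w := w) hx
  have := hm.le (h (m.toNat + 1))
  omega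

lemma lt_one_iff_ordGE {x : D} : w x < 1 ↔ OrdGE w 1 x := by
  constructor
  · intro h
    have h0 : OrdGE w 0 x := by simpa [OrdGE] using h.le
    refine (ordEq_or_ordGE h0).resolve_left fun h1 => ?_
    simp only [OrdEq, neg_zero, WithZero.exp_zero] at h1
    exact h.ne h1
  · intro h
    refine lt_of_le_of_lt h ?_
    rw [← WithZero.exp_zero, WithZero.exp_lt_exp]
    omega

lemma le_one_iff_ordGE {x : D} : w x ≤ 1 ↔ OrdGE w 0 x := by simp [OrdGE]

lemma exists_ordEq_of_surjective (hw : Function.Surjective w) (n : ℤ) : ∃ z, OrdEq w n z :=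
  hw (WithZero.exp (-n))

/-- Successive approximation of the elements of `P` by elements of `G ≤ P`. -/
lemma exists_approx (P G : AddSubgroup D) (hGP : G ≤ P) (N : ℤ)
    (h : ∀ y ∈ P, ∀ n < N, OrdEq w n y → ∃ g ∈ G, OrdGE w (n + 1) (y - g)) (y : D) (hy : y ∈ P) :
    ∃ g ∈ G, OrdGE w N (y - g) := by
  have key : ∀ (m : ℕ) (y : D), y ∈ P → OrdGE w (N - m) y → ∃ g ∈ G, OrdGE w N (y - g) := by
    intro m
    induction m with
    | zero => exact fun y _ hN => ⟨0, G.zero_mem, by simpa using hN⟩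
    | succ m ih =>
      intro y hy hN
      rcases ordEq_or_ordGE hN with h1 | h1
      · obtain ⟨g, hg, hgy⟩ := h y hy _ (by omega) h1
        obtain ⟨g', hg', hg''⟩ := ih (y - g) (P.sub_mem hy (hGP hg))
          (hgy.mono (by push_cast; omega))
        exact ⟨g + g', G.add_mem hg hg', by rwa [← sub_sub]⟩
      · exact ih y hy (h1.mono (by push_cast; omega))
  rcases eq_or_ne y 0 with rfl | hy0
  · exact ⟨0, G.zero_mem, by simpa using ordGE_zero N⟩
  · obtain ⟨n, hn⟩ := exists_ordEq (w := w) hy0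
    exact key (N - n).toNat y hy (hn.ge.mono (by omega))

/-- Every sequence whose consecutive differences tend to zero has a limit. -/
def IsSeqComplete {R Γ : Type*} [Ring R] [LinearOrderedCommGroupWithZero Γ] (v : Valuation R Γ) :
    Prop :=
  ∀ d : ℕ → R, (∀ γ : Γ, γ ≠ 0 → ∃ M, ∀ n ≥ M, v (d (n + 1) - d n) ≤ γ) →
    ∃ x, ∀ γ : Γ, γ ≠ 0 → ∃ M, ∀ n ≥ M, v (x - d n) ≤ γ

lemma IsSeqComplete.exists_limit (hc : IsSeqComplete w) (d : ℕ → D) (a : ℤ)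
    (hd : ∀ n : ℕ, OrdGE w (a + n) (d (n + 1) - d n)) : ∃ x, ∀ n : ℕ, OrdGE w (a + n) (x - d n) := by
  obtain ⟨x, hx⟩ := hc d (by
    intro γ hγ
    refine ⟨(-(WithZero.log γ) - a).toNat, fun n hn => (hd n).trans ?_⟩
    rw [← WithZero.exp_log hγ, WithZero.exp_le_exp]
    omega)
  refine ⟨x, fun n => ?_⟩
  have hmono : ∀ m : ℕ, OrdGE w (a + n) (d (n + m) - d n) := by
    intro m
    induction m with
    | zero => simpa using ordGE_zero _
    | succ m ih =>
      have := ((hd (n + m)).mono (m := a + n) (by push_cast; omega)).add ih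
      simpa [add_assoc] using this
  obtain ⟨M, hM⟩ := hx (WithZero.exp (-(a + n))) WithZero.exp_ne_zero
  have h1 : OrdGE w (a + n) (x - d (n + M)) := hM _ (by omega)
  simpa using h1.add (hmono M)

end Order

/-! ### Relative order of commutators. -/

section Commutator

variable {D : Type*} [DivisionRing D] {w : Valuation D ℤᵐ⁰}

lemma lie_mul_left (x y b : D) : ⁅x * y, b⁆ = x * ⁅y, b⁆ + ⁅x, b⁆ * y := by
  simp only [Ring.lie_def]; noncomm_ring

lemma lie_mul_right (a x y : D) : ⁅a, x * y⁆ = x * ⁅a, y⁆ + ⁅a, x⁆ * y := by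
  simp only [Ring.lie_def]; noncomm_ring

lemma lie_inv_left {x : D} (hx : x ≠ 0) (b : D) : ⁅x⁻¹, b⁆ = -(x⁻¹ * ⁅x, b⁆ * x⁻¹) := by
  simp only [Ring.lie_def, mul_sub, sub_mul, neg_sub]
  rw [inv_mul_cancel_left₀ hx, ← mul_assoc, mul_inv_cancel_right₀ hx]

/-- The elements commuting with `b` up to terms of relative order `m`, where `b` is of order `n`. -/
lemma relComm_mul {m n r s : ℤ} {x y b : D} (hx : OrdEq w r x) (hy : OrdEq w s y)
    (hxb : OrdGE w (r + n + m) ⁅x, b⁆) (hyb : OrdGE w (s + n + m) ⁅y, b⁆) :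
    OrdGE w ((r + s) + n + m) ⁅x * y, b⁆ := by
  rw [lie_mul_left]
  exact ((hx.ge.mul hyb).mono (by omega)).add ((hxb.mul hy.ge).mono (by omega))

lemma relComm_inv {m n r : ℤ} {x b : D} (hx : OrdEq w r x) (hxb : OrdGE w (r + n + m) ⁅x, b⁆) :
    OrdGE w (-r + n + m) ⁅x⁻¹, b⁆ := by
  rw [lie_inv_left hx.ne_zero]
  exact (((hx.inv.ge.mul hxb).mul hx.inv.ge).mono (by omega)).neg

lemma relComm_zpow {m n r : ℤ} {x b : D} (hx : OrdEq w r x) (hxb : OrdGE w (r + n + m) ⁅x, b⁆)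
    (j : ℤ) : OrdGE w (j * r + n + m) ⁅x ^ j, b⁆ := by
  have hpow : ∀ k : ℕ, OrdGE w (k * r + n + m) ⁅x ^ k, b⁆ := by
    intro k
    induction k with
    | zero => simpa [Ring.lie_def] using ordGE_zero _
    | succ k ih =>
      rw [pow_succ]
      exact (relComm_mul (hx.pow k) hx ih hxb).mono (by push_cast; linarith)
  cases j with
  | ofNat k => simpa using hpow k
  | negSucc k =>
    rw [zpow_negSucc]
    refine (relComm_inv (hx.pow (k + 1)) (hpow (k + 1))).mono ?_
    rw [Int.negSucc_eq]; push_cast; linarith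

end Commutator

end ValuedDivision

namespace ValuedDivision

/-! ### The level and the graded action of commutators. -/

section Level

attribute [local instance] LieRing.ofAssociativeRing

variable {F : Type*} [Field F] {D : Type*} [DivisionRing D] [Algebra F D] {w : Valuation D ℤᵐ⁰}

lemma algebraMap_lie (f : F) (b : D) : ⁅algebraMap F D f, b⁆ = 0 := by
  rw [Ring.lie_def, Algebra.commutes, sub_self]

/-- An integral element whose residue does not lie in the residue field of `F`. -/
def IsResidueGen (F : Type*) [Field F] {D : Type*} [DivisionRing D] [Algebra F D]
    (w : Valuation D ℤᵐ⁰) (x : D) : Prop :=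
  OrdGE w 0 x ∧ ∀ f : F, ¬ OrdGE w 1 (x - algebraMap F D f)

lemma IsResidueGen.ordEq {x : D} (hx : IsResidueGen F w x) : OrdEq w 0 x :=
  (ordEq_or_ordGE hx.1).resolve_right fun h => hx.2 0 (by simpa using h)

lemma IsResidueGen.of_sub {x y : D} (hx : IsResidueGen F w x) (h : OrdGE w 1 (y - x)) :
    IsResidueGen F w y := by
  refine ⟨by simpa using (h.mono zero_le_one).add hx.1, fun f hf => hx.2 f ?_⟩
  simpa using hf.sub h

lemma IsResidueGen.conj {x z : D} {n : ℤ} (hx : IsResidueGen F w x) (hz : OrdEq w n z) :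
    IsResidueGen F w (z * x * z⁻¹) := by
  refine ⟨((hz.ge.mul hx.1).mul hz.inv.ge).mono (by omega), fun f hf => hx.2 f ?_⟩
  have := ((hz.inv.ge.mul hf).mul hz.ge).mono (m := 1) (by omega)
  have e : z⁻¹ * (z * x * z⁻¹ - algebraMap F D f) * z = x - algebraMap F D f := by
    rw [mul_sub, sub_mul, ← Algebra.commutes f z⁻¹, mul_assoc (algebraMap F D f),
      inv_mul_cancel₀ hz.ne_zero, mul_one, mul_assoc z x, inv_mul_cancel_left₀ hz.ne_zero,
      inv_mul_cancel_right₀ hz.ne_zero]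
  rwa [e] at this

/-- A division algebra with commutative residue ring of prime degree `p` over the residue field of
`F` and ramification index `p`, in terms of the orders of its elements. -/
structure IsPrimeRamified (F : Type*) [Field F] {D : Type*} [DivisionRing D] [Algebra F D]
    (w : Valuation D ℤᵐ⁰) (p : ℕ) (t : F) : Prop where
  prime : p.Prime
  surj : Function.Surjective w
  ord_t : OrdEq w p (algebraMap F D t)
  exists_gen : ∃ x, IsResidueGen F w x
  gen : ∀ x, IsResidueGen F w x → ∀ S : Subring D, x ∈ S →
    (∀ f : F, OrdGE w 0 (algebraMap F D f) → algebraMap F D f ∈ S) →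
    ∀ y, OrdGE w 0 y → ∃ g ∈ S, OrdGE w 1 (y - g)

/-- `i` is the largest integer such that the commutators `⁅a, b⁆` have relative order
at least `i`. -/
structure IsLevel (w : Valuation D ℤᵐ⁰) (i : ℕ) : Prop where
  le : ∀ {a b : D} {m n : ℤ}, OrdGE w m a → OrdGE w n b → OrdGE w (m + n + i) ⁅a, b⁆
  attained : ∃ (a b : D) (m n : ℤ), OrdEq w m a ∧ OrdEq w n b ∧ OrdEq w (m + n + i) ⁅a, b⁆

lemma ordGE_lie {a b : D} {m n : ℤ} (ha : OrdGE w m a) (hb : OrdGE w n b) :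
    OrdGE w (m + n) ⁅a, b⁆ := by
  rw [Ring.lie_def]
  exact (ha.mul hb).sub ((hb.mul ha).mono (by omega))

/-- Relative orders of nonzero commutators are nonnegative integers, so noncommutativity alone
provides a minimum. -/
lemma exists_isLevel {a b : D} (hab : a * b ≠ b * a) : ∃ i, IsLevel w i := by
  classical
  have key : ∃ i : ℕ, ∃ (a b : D) (m n : ℤ), OrdEq w m a ∧ OrdEq w n b ∧
      OrdEq w (m + n + i) ⁅a, b⁆ := by
    have ha : a ≠ 0 := by rintro rfl; simp at hab
    have hb : b ≠ 0 := by rintro rfl; simp at hab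
    have hl : ⁅a, b⁆ ≠ 0 := by rwa [Ring.lie_def, sub_ne_zero]
    obtain ⟨m, hm⟩ := exists_ordEq (w := w) ha
    obtain ⟨n, hn⟩ := exists_ordEq (w := w) hb
    obtain ⟨r, hr⟩ := exists_ordEq (w := w) hl
    have := hr.le (ordGE_lie hm.ge hn.ge)
    refine ⟨(r - (m + n)).toNat, a, b, m, n, hm, hn, ?_⟩
    rw [Int.toNat_of_nonneg (by omega)]
    simpa using hr
  refine ⟨Nat.find key, ?_, Nat.find_spec key⟩
  intro a b m n ha hb
  rcases eq_or_ne ⁅a, b⁆ 0 with h0 | hl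
  · rw [h0]; exact ordGE_zero _
  have ha0 : a ≠ 0 := by rintro rfl; simp at hl
  have hb0 : b ≠ 0 := by rintro rfl; simp at hl
  obtain ⟨m', hm⟩ := exists_ordEq (w := w) ha0
  obtain ⟨n', hn⟩ := exists_ordEq (w := w) hb0
  obtain ⟨r, hr⟩ := exists_ordEq (w := w) hl
  have h1 := hr.le (ordGE_lie hm.ge hn.ge)
  have h2 := hm.le ha
  have h3 := hn.le hb
  have := Nat.find_min' key (m := (r - (m' + n')).toNat) ⟨a, b, m', n', hm, hn, by
    rw [Int.toNat_of_nonneg (by omega)]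
    simpa using hr⟩
  exact hr.ge.mono (by omega)

/-- The integral elements commuting with `b` up to terms of order `m`. -/
def almostCentralizer (w : Valuation D ℤᵐ⁰) (m : ℤ) (b : D) : Subring D where
  carrier := {a | OrdGE w 0 a ∧ OrdGE w m ⁅a, b⁆}
  mul_mem' {x y} hx hy := ⟨by simpa using hx.1.mul hy.1, by
    rw [lie_mul_left]
    exact ((hx.1.mul hy.2).mono (by omega)).add ((hx.2.mul hy.1).mono (by omega))⟩
  one_mem' := ⟨ordEq_one.ge, by simpa [Ring.lie_def] using ordGE_zero _⟩
  add_mem' {x y} hx hy := ⟨hx.1.add hy.1, by rw [add_lie]; exact hx.2.add hy.2⟩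
  zero_mem' := ⟨ordGE_zero _, by simpa using ordGE_zero _⟩
  neg_mem' {x} hx := ⟨hx.1.neg, by rw [neg_lie]; exact hx.2.neg⟩

variable {p : ℕ} {t : F} {i : ℕ}

section

variable (H : IsPrimeRamified F w p t)
include H

/-- The centralizer of x is a subring containing x and F, hence reaches every residue. -/
lemma IsPrimeRamified.exists_mem_centralizer {x y : D} (hx : IsResidueGen F w x)
    (hy : OrdGE w 0 y) : ∃ g, ⁅g, x⁆ = 0 ∧ OrdGE w 1 (y - g) := by
  obtain ⟨g, hg, hg'⟩ := H.gen x hx (Subring.centralizer {x}) (by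
    rw [Subring.mem_centralizer_iff]; simp) (by
    intro f _
    rw [Subring.mem_centralizer_iff]
    simp [Algebra.commutes]) y hy
  refine ⟨g, ?_, hg'⟩
  rw [Subring.mem_centralizer_iff] at hg
  rw [Ring.lie_def, hg x rfl, sub_self]

lemma IsPrimeRamified.exists_almostCentralizer {x : D} (hx : IsResidueGen F w x) {m : ℤ} {b : D}
    (hb : OrdGE w m ⁅x, b⁆) {y : D} (hy : OrdGE w 0 y) :
    ∃ g, OrdGE w m ⁅g, b⁆ ∧ OrdGE w 1 (y - g) := by
  obtain ⟨g, hg, hg'⟩ := H.gen x hx (almostCentralizer w m b) ⟨hx.1, hb⟩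
    (fun f hf => ⟨hf, by rw [algebraMap_lie]; exact ordGE_zero _⟩) y hy
  exact ⟨g, hg.2, hg'⟩

/-- Modulo elements of order 1 both entries are polynomials in one x over F, which commute; the
remainders contribute the extra 1. -/
lemma IsPrimeRamified.ordGE_lie_of_integral (hi : IsLevel w i) {y y' : D} (hy : OrdGE w 0 y)
    (hy' : OrdGE w 0 y') : OrdGE w (i + 1) ⁅y, y'⁆ := by
  obtain ⟨x, hx⟩ := H.exists_gen
  have h1 : OrdGE w (i + 1) ⁅x, y'⁆ := by
    obtain ⟨g, hg, hg'⟩ := H.exists_mem_centralizer hx hy'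
    have e : ⁅x, y'⁆ = ⁅x, y' - g⁆ := by
      rw [lie_sub, ← lie_skew x g, hg, neg_zero, sub_zero]
    rw [e]
    exact (hi.le hx.1 hg').mono (by omega)
  obtain ⟨g, hg, hg'⟩ := H.exists_almostCentralizer hx h1 hy
  have e : ⁅y, y'⁆ = ⁅g, y'⁆ + ⁅y - g, y'⁆ := by rw [sub_lie]; abel
  rw [e]
  exact hg.add ((hi.le hg' hy').mono (by omega))

/-- D is generated multiplicatively by z and units, and units commute with each other beyond the
level. If z and x did too, so would every pair, and the level would not be attained. -/
lemma IsPrimeRamified.ordEq_lie_uniformizer (hi : IsLevel w i) {x z : D} (hx : IsResidueGen F w x)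
    (hz : OrdEq w 1 z) : OrdEq w (i + 1) ⁅z, x⁆ := by
  have h1 := (hi.le hz.ge hx.1).mono (m := i + 1) (by omega)
  refine (ordEq_or_ordGE h1).resolve_right fun h2 => ?_
  -- every integral element commutes with `z` to higher order
  have h3 : ∀ y, OrdGE w 0 y → OrdGE w (1 + 0 + (i + 1)) ⁅z, y⁆ := by
    intro y hy
    have h2' : OrdGE w (1 + 0 + (i + 1)) ⁅x, z⁆ := by
      rw [← lie_skew x z]; exact (h2.mono (by omega)).neg
    obtain ⟨g, hg, hg'⟩ := H.exists_almostCentralizer hx h2' hy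
    have e : ⁅z, y⁆ = ⁅z, y - g⁆ - ⁅g, z⁆ := by rw [lie_sub, ← lie_skew z g]; abel
    rw [e]
    exact ((hi.le hz.ge hg').mono (by omega)).sub hg
  -- decomposition `d = u * z ^ n`
  have h4 : ∀ d n, OrdEq w n d → OrdGE w 0 (d * z ^ (-n)) ∧ OrdEq w 0 (d * z ^ (-n)) ∧
      d = (d * z ^ (-n)) * z ^ n := by
    intro d n hd
    have := hd.mul (hz.zpow (-n))
    rw [show n + -n * 1 = 0 by ring] at this
    refine ⟨this.ge, this, ?_⟩
    rw [mul_assoc, ← zpow_add₀ hz.ne_zero]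
    simp
  have h5 : ∀ d n y, OrdEq w n d → OrdEq w 0 y → OrdGE w (n + 0 + (i + 1)) ⁅d, y⁆ := by
    intro d n y hd hy
    obtain ⟨h6, h7, h8⟩ := h4 d n hd
    rw [h8]
    refine (relComm_mul (r := 0) (s := n * 1) h7 (hz.zpow n) ?_
      (relComm_zpow hz (h3 y hy.ge) n)).mono (by omega)
    exact (H.ordGE_lie_of_integral hi h6 hy.ge).mono (by omega)
  have h6 : ∀ d n, OrdEq w n d → OrdGE w (1 + n + (i + 1)) ⁅z, d⁆ := by
    intro d n hd
    obtain ⟨h6, h7, h8⟩ := h4 d n hd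
    have : ⁅z, d⁆ = ⁅z, d * z ^ (-n)⁆ * z ^ n := by
      conv_lhs => rw [h8]
      rw [lie_mul_right]
      have : ⁅z, z ^ n⁆ = 0 := by
        rw [Ring.lie_def, ((Commute.refl z).zpow_right₀ n).eq, sub_self]
      rw [this]; simp
    rw [this]
    exact ((h3 _ h6).mul (hz.zpow n).ge).mono (by omega)
  obtain ⟨a, b, m, n, ha, hb, hab⟩ := hi.attained
  obtain ⟨h7, h8, h9⟩ := h4 a m ha
  have : OrdGE w (m + n + (i + 1)) ⁅a, b⁆ := by
    rw [h9]
    refine (relComm_mul (r := 0) (s := m * 1) (n := n) h8 (hz.zpow m) ?_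
      (relComm_zpow hz (h6 b n hb) m)).mono (by omega)
    rw [← lie_skew]
    exact ((h5 b n _ hb h8).mono (by omega)).neg
  have := hab.le this
  omega

lemma IsPrimeRamified.ordEq_lie (hi : IsLevel w i) {x d : D} {n : ℤ} (hx : IsResidueGen F w x)
    (hd : OrdEq w n d) (hn : ¬ (p : ℤ) ∣ n) : OrdEq w (n + i) ⁅d, x⁆ := by
  have h1 := (hi.le hd.ge hx.1).mono (m := n + i) (by omega)
  refine (ordEq_or_ordGE h1).resolve_right fun h2 => ?_
  have hcop : IsCoprime n (p : ℤ) :=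
    ((Nat.prime_iff_prime_int.1 H.prime).coprime_iff_not_dvd.2 hn).symm
  -- By Bezout d^a t^b is a uniformizer; t is central, so it would commute with x beyond the level.
  obtain ⟨a, b, hab⟩ := hcop
  have ha := relComm_zpow (n := 0) (m := i + 1) hd (h2.mono (by omega)) a
  have hb : OrdGE w (b * p + 0 + (i + 1)) ⁅algebraMap F D t ^ b, x⁆ := by
    refine relComm_zpow H.ord_t ?_ b
    rw [algebraMap_lie]; exact ordGE_zero _
  have hz := (hd.zpow a).mul (H.ord_t.zpow b)
  rw [hab] at hz
  have := relComm_mul (hd.zpow a) (H.ord_t.zpow b) ha hb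
  rw [hab] at this
  refine not_ordGE_succ (H.ordEq_lie_uniformizer hi hx hz) (this.mono (by omega))

lemma IsPrimeRamified.exists_t_mul_unit {y : D} {n : ℤ} (hy : OrdEq w n y) (hn : (p : ℤ) ∣ n) :
    ∃ (f : F) (y₀ : D), OrdEq w n (algebraMap F D f) ∧ OrdEq w 0 y₀ ∧
      y = algebraMap F D f * y₀ := by
  obtain ⟨m, rfl⟩ := hn
  have ht := H.ord_t.zpow m
  rw [mul_comm] at ht
  refine ⟨t ^ m, algebraMap F D (t ^ m)⁻¹ * y, by rwa [map_zpow₀], ?_, ?_⟩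
  · have := ht.inv.mul hy
    rw [map_inv₀, map_zpow₀]
    simpa using this
  · rw [map_inv₀, mul_inv_cancel_left₀]
    rw [map_zpow₀]
    exact ht.ne_zero

/-- An element that commutes with `D` to high order is close to the center. -/
lemma IsPrimeRamified.exists_near_center (hi : IsLevel w i) (N : ℤ) (y : D)
    (hy : ∀ d n, OrdEq w n d → OrdGE w (N + n + i) ⁅y, d⁆) :
    ∃ f : F, OrdGE w N (y - algebraMap F D f) := by
  let P : AddSubgroup D :=
    { carrier := {y | ∀ d n, OrdEq w n d → OrdGE w (N + n + i) ⁅y, d⁆}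
      add_mem' := fun {a b} ha hb d n hd => by
        rw [add_lie]; exact (ha d n hd).add (hb d n hd)
      zero_mem' := fun d n hd => by rw [zero_lie]; exact ordGE_zero _
      neg_mem' := fun {a} ha d n hd => by rw [neg_lie]; exact (ha d n hd).neg }
  let G : AddSubgroup D := (algebraMap F D).range.toAddSubgroup
  obtain ⟨x, hx⟩ := H.exists_gen
  obtain ⟨z, hz⟩ := exists_ordEq_of_surjective H.surj 1
  have hGP : G ≤ P := by
    rintro _ ⟨f, rfl⟩ d n hd
    rw [algebraMap_lie]; exact ordGE_zero _
  obtain ⟨g, ⟨f, rfl⟩, hg⟩ := exists_approx P G hGP N (by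
    -- The leading term of y is tested twice: the commutator with x forces p ∣ n, and the commutator
    -- with a uniformizer forces the residue of the unit part into F̄.
    intro y hy n hn hyn
    have hdvd : (p : ℤ) ∣ n := by
      by_contra hnd
      have := (H.ordEq_lie hi hx hyn hnd).le (hy x 0 hx.ordEq)
      omega
    obtain ⟨f, y₀, hf, hy₀, rfl⟩ := H.exists_t_mul_unit hyn hdvd
    by_cases hgen : IsResidueGen F w y₀
    · have h1 := hf.mul (H.ordEq_lie_uniformizer hi hgen hz).neg
      rw [lie_skew y₀ z] at h1
      have h2 : ⁅algebraMap F D f * y₀, z⁆ = algebraMap F D f * ⁅y₀, z⁆ := by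
        rw [lie_mul_left, algebraMap_lie, zero_mul, add_zero]
      rw [← h2] at h1
      have := h1.le (hy z 1 hz)
      omega
    · simp only [IsResidueGen, not_and, not_forall, not_not] at hgen
      obtain ⟨f', hf'⟩ := hgen hy₀.ge
      refine ⟨_, ⟨f * f', rfl⟩, ?_⟩
      rw [map_mul, ← mul_sub]
      exact hf.ge.mul hf') y hy
  exact ⟨f, hg⟩

/-- The commutator with a residue generator is surjective on graded pieces of order prime to `p`. -/
lemma IsPrimeRamified.exists_lie_approx (hi : IsLevel w i) {l y : D} {n : ℤ}
    (hl : IsResidueGen F w l) (hn : ¬ (p : ℤ) ∣ n) (hy : OrdEq w (n + i) y) :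
    ∃ q, OrdEq w n q ∧ OrdGE w (n + i + 1) (⁅q, l⁆ - y) := by
  -- For any d of order n, the unit y[d,l]⁻¹ agrees to leading order with some g commuting with l,
  -- and [gd,l] = g[d,l].
  obtain ⟨d, hd⟩ := exists_ordEq_of_surjective H.surj n
  have h1 := H.ordEq_lie hi hl hd hn
  have hk := hy.mul h1.inv
  rw [show n + i + -(n + i) = 0 by ring] at hk
  obtain ⟨g, hg, hg'⟩ := H.exists_mem_centralizer hl hk.ge
  have hg0 : OrdEq w 0 g := hk.of_sub (by simpa using hg'.sub_symm)
  refine ⟨g * d, by simpa using hg0.mul hd, ?_⟩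
  rw [lie_mul_left, hg, zero_mul, add_zero]
  have := (hg'.sub_symm.mul h1.ge).mono (m := n + i + 1) (by omega)
  rwa [sub_mul, inv_mul_cancel_right₀ h1.ne_zero] at this

lemma IsPrimeRamified.dvd_of_lie_eq_zero (hi : IsLevel w i) {x d : D} {n : ℤ}
    (hx : IsResidueGen F w x) (hd : OrdEq w n d) (h : ⁅d, x⁆ = 0) : (p : ℤ) ∣ n := by
  by_contra hn
  exact (H.ordEq_lie hi hx hd hn).ne_zero h

/-- Elements of order divisible by `p` are approximated by elements commuting with `x`. -/
lemma IsPrimeRamified.exists_centralizer_approx {x y : D} {n : ℤ}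
    (hx : IsResidueGen F w x) (hy : OrdEq w n y) (hn : (p : ℤ) ∣ n) :
    ∃ g, ⁅g, x⁆ = 0 ∧ OrdGE w (n + 1) (y - g) := by
  obtain ⟨f, y₀, hf, hy₀, rfl⟩ := H.exists_t_mul_unit hy hn
  obtain ⟨g, hg, hg'⟩ := H.exists_mem_centralizer hx hy₀.ge
  refine ⟨algebraMap F D f * g, ?_, ?_⟩
  · rw [lie_mul_left, hg, algebraMap_lie]; simp
  · rw [← mul_sub]; exact hf.ge.mul hg'

/-- F[x] is dense in the centralizer: orders there are divisible by p, so a power of t reduces each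
leading term to a residue in F̄[x̄]. -/
lemma IsPrimeRamified.exists_adjoin_approx (hi : IsLevel w i) {x y : D}
    (hx : IsResidueGen F w x) (hy : ⁅y, x⁆ = 0) (N : ℤ) :
    ∃ g ∈ Algebra.adjoin F {x}, OrdGE w N (y - g) := by
  let P : AddSubgroup D :=
    { carrier := {y | ⁅y, x⁆ = 0}
      add_mem' := fun {a b} ha hb => by
        simp only [Set.mem_ofPred_eq] at *; rw [add_lie, ha, hb, add_zero]
      zero_mem' := by simp
      neg_mem' := fun {a} ha => by simp only [Set.mem_ofPred_eq] at *; rw [neg_lie, ha, neg_zero] }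
  refine exists_approx P (Algebra.adjoin F {x}).toSubring.toAddSubgroup ?_ N ?_ y hy
  · intro g hg
    have : g ∈ Subalgebra.centralizer F {x} := by
      refine Algebra.adjoin_le ?_ hg
      simp [Set.mem_centralizer_iff]
    rw [Subalgebra.mem_centralizer_iff] at this
    change ⁅g, x⁆ = 0
    rw [Ring.lie_def, this x rfl, sub_self]
  · intro y hy n _ hyn
    obtain ⟨f, y₀, hf, hy₀, rfl⟩ := H.exists_t_mul_unit hyn (H.dvd_of_lie_eq_zero hi hx hyn hy)
    obtain ⟨g, hg, hg'⟩ := H.gen x hx (Algebra.adjoin F {x}).toSubring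
      (Algebra.self_mem_adjoin_singleton F x)
      (fun f _ => Subalgebra.algebraMap_mem _ f) y₀ hy₀.ge
    refine ⟨algebraMap F D f * g, Subalgebra.mul_mem _ (Subalgebra.algebraMap_mem _ f) hg, ?_⟩
    rw [← mul_sub]
    exact hf.ge.mul hg'

/-- y' commutes with F[x], and y is a limit of elements of F[x]. -/
lemma IsPrimeRamified.centralizer_comm (hi : IsLevel w i) {x y y' : D}
    (hx : IsResidueGen F w x) (hy : ⁅y, x⁆ = 0) (hy' : ⁅y', x⁆ = 0) : ⁅y, y'⁆ = 0 := by
  rcases eq_or_ne y' 0 with rfl | h0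
  · simp
  obtain ⟨m, hm⟩ := exists_ordEq (w := w) h0
  refine eq_zero_of_forall_ordGE (w := w) fun N => ?_
  obtain ⟨g, hg, hg'⟩ := H.exists_adjoin_approx hi hx hy (N - m)
  have : g ∈ Subalgebra.centralizer F {y'} := by
    refine Algebra.adjoin_le ?_ hg
    rw [Ring.lie_def, sub_eq_zero] at hy'
    simp [Set.mem_centralizer_iff, hy']
  rw [Subalgebra.mem_centralizer_iff] at this
  have e : ⁅y, y'⁆ = ⁅y - g, y'⁆ := by
    rw [sub_lie, Ring.lie_def g, this y' rfl, sub_self, sub_zero]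
  rw [e]
  exact (ordGE_lie hg' hm.ge).mono (by omega)

end

end Level

end ValuedDivision

namespace ValuedDivision

lemma exists_seq_of_step {α : Type*} (Q : ℕ → α → Prop) (R : ℕ → α → α → Prop) (a : α)
    (h0 : Q 0 a) (h : ∀ n a, Q n a → ∃ b, Q (n + 1) b ∧ R n a b) :
    ∃ s : ℕ → α, (∀ n, Q n (s n)) ∧ ∀ n, R n (s n) (s (n + 1)) := by
  choose! g hg hR using h
  let s : ℕ → α := fun n => Nat.rec a (fun n b => g n b) n
  have hs : ∀ n, Q n (s n) := by
    intro n
    induction n with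
    | zero => exact h0
    | succ n ih => exact hg n _ ih
  exact ⟨s, hs, fun n => hR n _ (hs n)⟩

/-! ### Level divisible by p: a uniformizer normalizing a centralizer. -/

section Normalizer

attribute [local instance] LieRing.ofAssociativeRing

variable {F : Type*} [Field F] {D : Type*} [DivisionRing D] [Algebra F D] {w : Valuation D ℤᵐ⁰}
  {p : ℕ} {t : F} {i : ℕ}

lemma conj_one_add_mul {q v x l : D} (hq : 1 + q ≠ 0) :
    ((1 + q) * v) * x * ((1 + q) * v)⁻¹ - l =
      (⁅q, l⁆ + (v * x * v⁻¹ - l) + q * (v * x * v⁻¹ - l)) * (1 + q)⁻¹ := by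
  rw [eq_mul_inv_iff_mul_eq₀ hq, mul_inv_rev, sub_mul, mul_assoc, mul_assoc v⁻¹,
    inv_mul_cancel₀ hq, mul_one, Ring.lie_def]
  noncomm_ring

/-- The error has order i + n + 1 with p ∣ i. If p ∣ n + 1, its leading term lies in Z(x) and is
absorbed into l. Otherwise it equals -[q,l] to leading order for some q of order n + 1, and v is
replaced by (1 + q)v. -/
lemma IsPrimeRamified.normalizer_step (H : IsPrimeRamified F w p t) (hi : IsLevel w i)
    (hpi : p ∣ i) {x v l : D} {n : ℕ} (hx : IsResidueGen F w x) (hv : OrdEq w 1 v)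
    (hl : IsResidueGen F w l) (hlx : ⁅l, x⁆ = 0) (h : OrdGE w (i + n + 1) (v * x * v⁻¹ - l)) :
    ∃ v' l', OrdEq w 1 v' ∧ IsResidueGen F w l' ∧ ⁅l', x⁆ = 0 ∧
      OrdGE w (i + n + 2) (v' * x * v'⁻¹ - l') ∧ OrdGE w (2 + n) (v' - v) ∧
      OrdGE w (1 + n) (l' - l) := by
  rcases ordEq_or_ordGE h with h1 | h1
  · by_cases hn : (p : ℤ) ∣ n + 1
    · obtain ⟨g, hg, hg'⟩ := H.exists_centralizer_approx hx h1
        (by rw [add_assoc]; exact dvd_add (Int.natCast_dvd_natCast.2 hpi) hn)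
      have hg0 : OrdGE w (1 + n) g := by
        have := (h1.of_sub hg'.sub_symm).ge
        exact this.mono (by omega)
      refine ⟨v, l + g, hv, hl.of_sub (by simpa using hg0.mono (by omega)), ?_, ?_, ?_, ?_⟩
      · rw [add_lie, hlx, hg, add_zero]
      · rw [← sub_sub]; exact hg'.mono (by omega)
      · rw [sub_self]; exact ordGE_zero _
      · simpa using hg0
    · have h2 : OrdEq w ((n + 1) + i) (-(v * x * v⁻¹ - l)) := by
        rw [show ((n : ℤ) + 1) + i = i + n + 1 by ring]; exact h1.neg
      obtain ⟨q, hq, hq'⟩ := H.exists_lie_approx hi hl hn h2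
      have h1q : OrdEq w 0 (1 + q) := ordEq_one.of_sub (by simpa using hq.ge.mono (by omega))
      refine ⟨(1 + q) * v, l, by simpa using h1q.mul hv, hl, hlx, ?_, ?_, ?_⟩
      · rw [conj_one_add_mul h1q.ne_zero]
        refine ((OrdGE.add ?_ ?_).mul h1q.inv.ge).mono (m := i + n + 2) (n := i + n + 2 + -0)
          (by omega)
        · rw [sub_neg_eq_add] at hq'
          exact hq'.mono (by omega)
        · exact (hq.ge.mul h1.ge).mono (by omega)
      · rw [add_mul, one_mul, add_sub_cancel_left]
        exact (hq.ge.mul hv.ge).mono (by omega)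
      · rw [sub_self]; exact ordGE_zero _
  · refine ⟨v, l, hv, hl, hlx, h1.mono (by omega), ?_, ?_⟩ <;>
    · rw [sub_self]; exact ordGE_zero _

/-- If `p` divides the level, then the centralizer of a residue generator is normalized by a
uniformizer. -/
lemma IsPrimeRamified.exists_normalizer (H : IsPrimeRamified F w p t) (hc : IsSeqComplete w)
    (hi : IsLevel w i) (hpi : p ∣ i) {x : D} (hx : IsResidueGen F w x) :
    ∃ v l, OrdEq w 1 v ∧ ⁅l, x⁆ = 0 ∧ v * x = l * v := by
  obtain ⟨z, hz⟩ := exists_ordEq_of_surjective H.surj 1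
  have h0 : OrdEq w i (z * x * z⁻¹ - x) := by
    have := (H.ordEq_lie_uniformizer hi hx hz).mul hz.inv
    rw [Ring.lie_def, sub_mul, mul_assoc x, mul_inv_cancel₀ hz.ne_zero, mul_one] at this
    simpa using this
  -- zxz⁻¹ - x has order i, which p divides, so its leading term can be taken in Z(x); this also
  -- covers i = 0.
  obtain ⟨g, hg, hg'⟩ := H.exists_centralizer_approx hx h0 (Int.natCast_dvd_natCast.2 hpi)
  have h1 : OrdGE w (i + (0 : ℕ) + 1) (z * x * z⁻¹ - (x + g)) := by
    rw [← sub_sub]; simpa using hg'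
  have hl0 : IsResidueGen F w (x + g) := (hx.conj hz).of_sub (by
    exact h1.sub_symm.mono (by push_cast; omega))
  have hlx0 : ⁅x + g, x⁆ = 0 := by rw [add_lie, hg, lie_self, add_zero]
  obtain ⟨s, hs, hR⟩ := exists_seq_of_step
    (fun n (a : D × D) => OrdEq w 1 a.1 ∧ IsResidueGen F w a.2 ∧ ⁅a.2, x⁆ = 0 ∧
      OrdGE w (i + n + 1) (a.1 * x * a.1⁻¹ - a.2))
    (fun n a b => OrdGE w (2 + n) (b.1 - a.1) ∧ OrdGE w (1 + n) (b.2 - a.2))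
    (z, x + g) ⟨hz, hl0, hlx0, h1⟩ (by
      rintro n ⟨v, l⟩ ⟨hv, hl, hlx, h⟩
      obtain ⟨v', l', h1, h2, h3, h4, h5, h6⟩ := H.normalizer_step hi hpi hx hv hl hlx h
      exact ⟨(v', l'), ⟨h1, h2, h3, h4.mono (by push_cast; omega)⟩, h5, h6⟩)
  obtain ⟨v, hv⟩ := hc.exists_limit (fun n => (s n).1) 2 fun n => (hR n).1
  obtain ⟨l, hl⟩ := hc.exists_limit (fun n => (s n).2) 1 fun n => (hR n).2
  have hv1 : OrdEq w 1 v := (hs 0).1.of_sub ((hv 0).mono (by norm_num))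
  have hl1 : OrdGE w 0 l := by
    simpa using ((hl 0).mono (m := 0) (by norm_num)).add (hs 0).2.1.1
  refine ⟨v, l, hv1, ?_, ?_⟩
  · refine eq_zero_of_forall_ordGE (w := w) fun n => ?_
    have e : ⁅l, x⁆ = ⁅l - (s n).2, x⁆ := by rw [sub_lie, (hs n).2.2.1, sub_zero]
    rw [e]
    exact (ordGE_lie (hl n) hx.1).mono (by omega)
  · rw [← sub_eq_zero]
    refine eq_zero_of_forall_ordGE (w := w) fun n => ?_
    obtain ⟨h1, h2, h3, h4⟩ := hs n
    have e : v * x - l * v = (v - (s n).1) * x + ((s n).1 * x * (s n).1⁻¹ - (s n).2) * (s n).1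
        - (l - (s n).2) * (s n).1 - l * (v - (s n).1) := by
      rw [sub_mul (_ * _), inv_mul_cancel_right₀ h1.ne_zero]
      noncomm_ring
    rw [e]
    refine OrdGE.sub (OrdGE.sub (OrdGE.add ?_ ?_) ?_) ?_
    · exact ((hv n).mul hx.1).mono (by omega)
    · exact (h4.mul h1.ge).mono (by omega)
    · exact ((hl n).mul h1.ge).mono (by omega)
    · exact (hl1.mul (hv n)).mono (by omega)

end Normalizer

/-! ### Inner derivations in characteristic p. -/

section CharP

lemma natCast_choose_pred {R : Type*} [Ring R] (p : ℕ) [hp : Fact p.Prime] [CharP R p] {m : ℕ}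
    (hm : m < p) : (((p - 1).choose m : ℕ) : R) = (-1) ^ m := by
  induction m with
  | zero => simp
  | succ m ih =>
    have h1 : p.choose (m + 1) = (p - 1).choose m + (p - 1).choose (m + 1) := by
      conv_lhs => rw [← Nat.succ_pred_eq_of_pos hp.out.pos]
      exact Nat.choose_succ_succ' _ _
    have h2 : ((p.choose (m + 1) : ℕ) : R) = 0 :=
      (CharP.cast_eq_zero_iff R p _).2 (hp.out.dvd_choose_self (by omega) hm)
    rw [h1, Nat.cast_add, ih (by omega)] at h2
    rw [pow_succ, mul_neg_one]
    exact (neg_eq_of_add_eq_zero_right h2).symm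

/-- The binomial coefficient of p - 1 over j is (-1)^j modulo p. It meets the sign of (-y)^(p-1-j),
and (-1)^(p-1) = 1, also for p = 2. -/
lemma _root_.Commute.sub_pow_char_pred {R : Type*} [Ring R] (p : ℕ) [hp : Fact p.Prime] [CharP R p]
    {x y : R} (h : Commute x y) :
    (x - y) ^ (p - 1) = ∑ j ∈ Finset.range p, x ^ j * y ^ (p - 1 - j) := by
  rw [sub_eq_add_neg, h.neg_right.add_pow, Nat.sub_add_cancel hp.out.one_le]
  refine Finset.sum_congr rfl fun j hj => ?_
  rw [Finset.mem_range] at hj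
  have h1 : (-1 : R) ^ (p - 1) = 1 := by
    rcases hp.out.eq_two_or_odd' with rfl | hodd
    · have := CharTwo.neg_eq (1 : R)
      simp [this]
    · exact (Nat.Odd.sub_odd hodd odd_one).neg_one_pow
  rw [natCast_choose_pred p hj, neg_pow y, mul_assoc, mul_assoc,
    (((Commute.neg_one_left y).pow_left j).pow_right (p - 1 - j)).symm.eq,
    ← mul_assoc ((-1 : R) ^ (p - 1 - j)), ← pow_add, Nat.sub_add_cancel (by omega), h1, one_mul]

variable {F : Type*} [Field F] {D : Type*} [Ring D] [Algebra F D]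

/-- The inner derivation of `x` as an `F`-linear map. -/
def innerDer (F : Type*) [Field F] {D : Type*} [Ring D] [Algebra F D] (x : D) : Module.End F D :=
  LinearMap.mulLeft F x - LinearMap.mulRight F x

lemma innerDer_apply (x y : D) : innerDer F x y = ⁅x, y⁆ := rfl

lemma innerDer_add (x y : D) : innerDer F (x + y) = innerDer F x + innerDer F y := by
  ext d; simp only [innerDer_apply, LinearMap.add_apply, Ring.lie_def]; noncomm_ring

lemma charP_end (p : ℕ) {M : Type*} [AddCommGroup M] [Module F M] [Nontrivial M] [CharP F p] :
    CharP (Module.End F M) p :=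
  charP_of_injective_algebraMap (algebraMap F (Module.End F M)).injective p

lemma innerDer_pow_char (p : ℕ) [Fact p.Prime] [CharP F p] [Nontrivial D] (x : D) :
    innerDer F x ^ p = innerDer F (x ^ p) := by
  have := charP_end (F := F) (M := D) p
  unfold innerDer
  rw [sub_pow_char_of_commute _ (LinearMap.commute_mulLeft_right x x), LinearMap.pow_mulLeft,
    LinearMap.pow_mulRight]

lemma innerDer_innerDer_pow (x q : D) (n : ℕ) :
    (innerDer F (innerDer F x) ^ n) (innerDer F q) = innerDer F ((innerDer F x ^ n) q) := by
  induction n with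
  | zero => rfl
  | succ n ih =>
    rw [pow_succ', pow_succ', Module.End.mul_apply, ih, Module.End.mul_apply]
    ext d
    simp only [innerDer_apply, Ring.lie_def, LinearMap.sub_apply, Module.End.mul_apply]
    noncomm_ring

/-- This is the part of ad(x+q)^p linear in q. Left and right multiplication by ad(x) commute, so
the sum is the (p-1)-st power of their difference, and that difference sends ad(q) to ad([x,q]). -/
lemma sum_pow_innerDer_pow (p : ℕ) [Fact p.Prime] [CharP F p] [Nontrivial D] (x q : D) :
    ∑ j ∈ Finset.range p, innerDer F x ^ j * innerDer F q * innerDer F x ^ (p - 1 - j) =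
      innerDer F ((innerDer F x ^ (p - 1)) q) := by
  rw [← innerDer_innerDer_pow]
  have : CharP (Module.End F (Module.End F D)) p := charP_end p
  conv_rhs => rw [innerDer]
  have h : Commute (LinearMap.mulLeft F (innerDer F x) : Module.End F (Module.End F D))
    (LinearMap.mulRight F (innerDer F x)) := LinearMap.commute_mulLeft_right _ _
  have h2 := Commute.sub_pow_char_pred (R := Module.End F (Module.End F D)) p h
  rw [h2, LinearMap.sum_apply]
  refine Finset.sum_congr rfl fun j _ => ?_
  rw [LinearMap.pow_mulLeft, LinearMap.pow_mulRight, Module.End.mul_apply,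
    LinearMap.mulLeft_apply, LinearMap.mulRight_apply, mul_assoc]

end CharP

/-! ### Level prime to p: a residue generator with central p-th power. -/

section PowerCentral

attribute [local instance] LieRing.ofAssociativeRing

variable {F : Type*} [Field F] {D : Type*} [DivisionRing D] [Algebra F D] {w : Valuation D ℤᵐ⁰}
  {p : ℕ} {t : F} {i : ℕ}

/-- The linear map `T` raises orders by at least `N`. -/
def OpGE (w : Valuation D ℤᵐ⁰) (N : ℤ) (T : Module.End F D) : Prop :=
  ∀ (d : D) (n : ℤ), OrdGE w n d → OrdGE w (n + N) (T d)

lemma OpGE.add {N : ℤ} {S T : Module.End F D} (hS : OpGE w N S) (hT : OpGE w N T) :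
    OpGE w N (S + T) := fun d n hd => (hS d n hd).add (hT d n hd)

lemma OpGE.mono {M N : ℤ} {T : Module.End F D} (hT : OpGE w N T) (h : M ≤ N) : OpGE w M T :=
  fun d n hd => (hT d n hd).mono (by omega)

lemma OpGE.mul {M N : ℤ} {S T : Module.End F D} (hS : OpGE w M S) (hT : OpGE w N T) :
    OpGE w (M + N) (S * T) := fun d n hd => (hS _ _ (hT d n hd)).mono (by omega)

lemma opGE_zero (N : ℤ) : OpGE w N (0 : Module.End F D) := fun _ _ _ => ordGE_zero _

lemma opGE_one : OpGE w 0 (1 : Module.End F D) := fun d n hd => by simpa using hd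

lemma OpGE.pow {N : ℤ} {T : Module.End F D} (hT : OpGE w N T) (m : ℕ) :
    OpGE w (m * N) (T ^ m) := by
  induction m with
  | zero => simpa using opGE_one
  | succ m ih =>
    rw [pow_succ]
    exact (ih.mul hT).mono (by push_cast; linarith)

lemma IsLevel.opGE (hi : IsLevel w i) {x : D} {n : ℤ} (hx : OrdGE w n x) :
    OpGE w (n + i) (innerDer F x) :=
  fun d m hd => (hi.le hx hd).mono (by omega)

/-- Noncommutative first-order expansion: words with at least two letters Q gain 2n, and all of them
go into E. -/
lemma OpGE.add_pow_sub {a n : ℤ} (hn : 0 ≤ n) {A Q : Module.End F D} (hA : OpGE w a A)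
    (hQ : OpGE w (a + n) Q) (m : ℕ) :
    OpGE w (m * a + n) (∑ j ∈ Finset.range m, A ^ j * Q * A ^ (m - 1 - j)) ∧
    ∃ E, OpGE w (m * a + 2 * n) E ∧
      (A + Q) ^ m = A ^ m + (∑ j ∈ Finset.range m, A ^ j * Q * A ^ (m - 1 - j)) + E := by
  induction m with
  | zero => exact ⟨by simpa using opGE_zero _, 0, opGE_zero _, by simp⟩
  | succ m ih =>
    obtain ⟨h1, E, hE, h2⟩ := ih
    have e : ∑ j ∈ Finset.range (m + 1), A ^ j * Q * A ^ (m + 1 - 1 - j) =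
        A * (∑ j ∈ Finset.range m, A ^ j * Q * A ^ (m - 1 - j)) + Q * A ^ m := by
      rw [Finset.sum_range_succ', Finset.mul_sum]
      congr 1
      · refine Finset.sum_congr rfl fun j _ => ?_
        rw [pow_succ', show m + 1 - 1 - (j + 1) = m - 1 - j by omega]
        simp only [mul_assoc]
    rw [e]
    refine ⟨((hA.mul h1).mono ?_).add ((hQ.mul (hA.pow m)).mono ?_), _,
      (((hQ.mul h1).mono ?_).add (((hA.add (hQ.mono ?_)).mul hE).mono ?_)), ?_⟩
    · push_cast; linarith
    · push_cast; linarith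
    · push_cast; linarith
    · linarith
    · push_cast; linarith
    · rw [pow_succ', h2, pow_succ']
      noncomm_ring

lemma IsPrimeRamified.exists_innerDer_pow_approx (H : IsPrimeRamified F w p t) (hi : IsLevel w i)
    {x : D} (hx : IsResidueGen F w x) {n : ℤ} (j : ℕ) (hn : ∀ a < j, ¬ (p : ℤ) ∣ n + a * i) {y : D}
    (hy : OrdEq w (n + j * i) y) :
    ∃ q, OrdEq w n q ∧ OrdGE w (n + j * i + 1) ((innerDer F x ^ j) q - y) := by
  induction j generalizing y with
  | zero =>
    refine ⟨y, by simpa using hy, ?_⟩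
    simpa using ordGE_zero _
  | succ j ih =>
    -- The sign accounts for ad(x) being [x,·], while the approximation lemma treats [·,x].
    have hy' : OrdEq w ((n + j * i) + i) (-y) := by
      convert hy.neg using 1; push_cast; ring
    obtain ⟨q', hq', h1⟩ := H.exists_lie_approx hi hx (hn j (by omega)) hy'
    obtain ⟨q, hq, h2⟩ := ih (fun a ha => hn a (by omega)) hq'
    refine ⟨q, hq, ?_⟩
    have e : (innerDer F x ^ (j + 1)) q - y =
        innerDer F x ((innerDer F x ^ j) q - q') - (⁅q', x⁆ - -y) := by
      rw [pow_succ', Module.End.mul_apply, map_sub, innerDer_apply x q', ← lie_skew x q']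
      abel
    rw [e]
    refine OrdGE.sub ?_ (h1.mono (by push_cast; linarith))
    exact (hi.opGE (F := F) hx.1 _ _ h2).mono (by push_cast; linarith)

lemma ordGE_pow_sub_pow {a b : D} {n : ℤ} (ha : OrdGE w 0 a) (hb : OrdGE w 0 b)
    (h : OrdGE w n (a - b)) (m : ℕ) : OrdGE w n (a ^ m - b ^ m) := by
  induction m with
  | zero => simpa using ordGE_zero _
  | succ m ih =>
    have e : a ^ (m + 1) - b ^ (m + 1) = a ^ m * (a - b) + (a ^ m - b ^ m) * b := by
      rw [pow_succ, pow_succ]; noncomm_ring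
    rw [e]
    exact (((ha.pow m).mul h).mono (by simp)).add ((ih.mul hb).mono (by simp))

lemma IsPrimeRamified.pow_near_center_zero (H : IsPrimeRamified F w p t) [CharP F p]
    (hi : IsLevel w i) {x : D} (hx : OrdGE w 0 x) :
    ∃ f : F, OrdGE w ((p - 1) * i) (x ^ p - algebraMap F D f) := by
  have : Fact p.Prime := ⟨H.prime⟩
  refine H.exists_near_center hi _ _ fun d n hd => ?_
  rw [← innerDer_apply (F := F), ← innerDer_pow_char]
  exact (((hi.opGE (F := F) hx).pow p) d n hd.ge).mono (by linarith)

/-- Replacing x by x + q changes ad(x^p) by ad(ad(x)^(p-1) q) up to higher order, so q is chosen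
with ad(x)^(p-1) q cancelling the leading term of x^p - f. -/
lemma IsPrimeRamified.pow_near_center_step (H : IsPrimeRamified F w p t) [CharP F p]
    (hi : IsLevel w i) (hpi : ¬ p ∣ i) {x : D} (hx : IsResidueGen F w x) {n : ℕ} {f : F}
    (hf : OrdGE w ((p - 1) * i + n) (x ^ p - algebraMap F D f)) :
    ∃ x', IsResidueGen F w x' ∧ OrdGE w n (x' - x) ∧
      ∃ f' : F, OrdGE w ((p - 1) * i + n + 1) (x' ^ p - algebraMap F D f') := by
  have : Fact p.Prime := ⟨H.prime⟩
  rcases ordEq_or_ordGE hf with h1 | h1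
  swap
  · exact ⟨x, hx, by rw [sub_self]; exact ordGE_zero _, f, h1⟩
  have hcomm : ⁅x ^ p - algebraMap F D f, x⁆ = 0 := by
    rw [sub_lie, algebraMap_lie, sub_zero, Ring.lie_def, ← pow_succ, ← pow_succ', sub_self]
  -- The error commutes with x, so p divides (p-1)i + n, that is n ≡ i mod p. Then n + ai ≡ (a+1)i
  -- is nonzero mod p for a < p - 1, and every one of the p - 1 applications of ad(x) can be
  -- inverted on leading terms. It also gives n ≥ 1.
  have hdvd := H.dvd_of_lie_eq_zero hi hx h1 hcomm
  have hni : (p : ℤ) ∣ n - i := by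
    have := dvd_sub hdvd (dvd_mul_right (p : ℤ) i)
    ring_nf at this ⊢
    exact this
  have hpi' : ¬ (p : ℤ) ∣ i := fun h => hpi (Int.natCast_dvd_natCast.1 h)
  have hpp := Nat.prime_iff_prime_int.1 H.prime
  have hn : ∀ a < p - 1, ¬ (p : ℤ) ∣ n + a * i := by
    intro a ha h
    have h2 : (p : ℤ) ∣ ((a + 1 : ℕ) : ℤ) * i := by
      have := dvd_sub h hni
      push_cast
      ring_nf at this ⊢
      exact this
    rcases hpp.dvd_or_dvd h2 with h3 | h3
    · have := Nat.le_of_dvd (by omega) (Int.natCast_dvd_natCast.1 h3)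
      omega
    · exact hpi' h3
  have hn0 : 1 ≤ n := by
    rcases Nat.eq_zero_or_pos n with rfl | h
    · refine absurd ?_ (hn 0 (by have := H.prime.two_le; omega))
      simp
    · exact h
  have hp1 : ((p - 1 : ℕ) : ℤ) = p - 1 := by
    rw [Nat.cast_sub H.prime.one_le]; simp
  have hy : OrdEq w (n + ((p - 1 : ℕ) : ℤ) * i) (-(x ^ p - algebraMap F D f)) := by
    rw [hp1, add_comm]; exact h1.neg
  obtain ⟨q, hq, hq'⟩ := H.exists_innerDer_pow_approx hi hx (p - 1) hn hy
  rw [hp1, sub_neg_eq_add] at hq'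
  refine ⟨x + q, hx.of_sub (by simpa using hq.ge.mono (by omega)), by simpa using hq.ge, ?_⟩
  refine H.exists_near_center hi _ _ fun d m hd => ?_
  rw [← innerDer_apply (F := F), ← innerDer_pow_char, innerDer_add]
  -- The remainder gains pi + 2n, which is at least the required pi + n + 1 because n ≥ 1.
  obtain ⟨-, E, hE, h2⟩ := OpGE.add_pow_sub (n := n) (by omega)
    ((hi.opGE (F := F) hx.1).mono (M := i) (by omega))
    ((hi.opGE (F := F) hq.ge).mono (M := i + n) (by omega)) p
  rw [h2, sum_pow_innerDer_pow, innerDer_pow_char, ← innerDer_add]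
  refine OrdGE.add ?_ ((hE d m hd.ge).mono ?_)
  · have e : innerDer F (x ^ p + (innerDer F x ^ (p - 1)) q) d =
        ⁅(innerDer F x ^ (p - 1)) q + (x ^ p - algebraMap F D f), d⁆ := by
      rw [innerDer_apply, add_lie, add_lie, sub_lie, algebraMap_lie, sub_zero, add_comm]
    rw [e]
    exact (hi.le hq' hd.ge).mono (by linarith)
  · linarith

/-- If `p` does not divide the level, there is a residue generator whose `p`-th power
is central. -/
lemma IsPrimeRamified.exists_pow_central (H : IsPrimeRamified F w p t) [CharP F p]
    (hc : IsSeqComplete w) (hi : IsLevel w i) (hpi : ¬ p ∣ i) :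
    ∃ x : D, IsResidueGen F w x ∧ ∀ d : D, ⁅x ^ p, d⁆ = 0 := by
  obtain ⟨x₀, hx₀⟩ := H.exists_gen
  obtain ⟨f₀, hf₀⟩ := H.pow_near_center_zero hi hx₀.1
  -- The step with n = 0 is taken separately, so that all corrections in the sequence have order at
  -- least 1 and keep the residue of x.
  obtain ⟨x₁, hx₁, -, f₁, hf₁⟩ := H.pow_near_center_step hi hpi hx₀ (n := 0) (by simpa using hf₀)
  obtain ⟨s, hs, hR⟩ := exists_seq_of_step
    (fun n (x : D) => IsResidueGen F w x ∧
      ∃ f : F, OrdGE w ((p - 1) * i + (n + 1 : ℕ)) (x ^ p - algebraMap F D f))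
    (fun n x y => OrdGE w (1 + n) (y - x)) x₁ ⟨hx₁, f₁, by simpa using hf₁⟩ (by
      rintro n x ⟨hx, f, hf⟩
      obtain ⟨x', hx', h1, f', h2⟩ := H.pow_near_center_step hi hpi hx hf
      exact ⟨x', ⟨hx', f', h2.mono (by push_cast; linarith)⟩, h1.mono (by push_cast; linarith)⟩)
  obtain ⟨x, hx⟩ := hc.exists_limit s 1 hR
  have hxg : IsResidueGen F w x := (hs 0).1.of_sub ((hx 0).mono (by simp))
  refine ⟨x, hxg, fun d => ?_⟩
  rcases eq_or_ne d 0 with rfl | hd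
  · simp
  obtain ⟨m, hm⟩ := exists_ordEq (w := w) hd
  refine eq_zero_of_forall_ordGE (w := w) fun N => ?_
  obtain ⟨h1, f, hf⟩ := hs (N - m).toNat
  set n := (N - m).toNat
  have e : ⁅x ^ p, d⁆ = ⁅x ^ p - s n ^ p, d⁆ + ⁅s n ^ p - algebraMap F D f, d⁆ := by
    rw [sub_lie, sub_lie, algebraMap_lie]; abel
  rw [e]
  have hp1 : (0 : ℤ) ≤ (p - 1) * i := by
    have := H.prime.one_le
    refine mul_nonneg ?_ (by omega)
    omega
  refine OrdGE.add ?_ ?_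
  · exact (ordGE_lie (ordGE_pow_sub_pow hxg.1 h1.1 (hx n) p) hm.ge).mono (by omega)
  · refine (ordGE_lie hf hm.ge).mono ?_
    push_cast
    have : (N : ℤ) - m ≤ n := by omega
    linarith

end PowerCentral

end ValuedDivision

namespace ValuedDivision

universe u

/-! ### Degrees of subfields of a central division algebra. -/

section Centralizer

variable {F : Type*} [Field F] {D : Type*} [DivisionRing D] [Algebra F D]

/-- Shortest-relation argument: normalize one coefficient to 1. Replacing y by yd and subtracting
the relation times d gives a shorter relation, so all coefficients are central and contradict the
independence of b over F. -/
lemma eq_zero_of_forall_sum_mul_mul_eq_zero [Algebra.IsCentral F D] {ι : Type*} {b : ι → D}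
    (hb : LinearIndependent F b) (s : Finset ι) (a : ι → D)
    (h : ∀ y, ∑ i ∈ s, b i * y * a i = 0) : ∀ i ∈ s, a i = 0 := by
  classical
  induction s using Finset.strongInduction generalizing a with
  | H s ih =>
    by_contra! hne
    obtain ⟨i₀, hi₀, h0⟩ := hne
    let a' : ι → D := fun i => a i * (a i₀)⁻¹
    have ha' : ∀ y, ∑ i ∈ s, b i * y * a' i = 0 := fun y => by
      simp only [a', ← mul_assoc, ← Finset.sum_mul, h y, zero_mul]
    have h1 : a' i₀ = 1 := mul_inv_cancel₀ h0
    have hcent : ∀ d, ∀ i ∈ s, d * a' i = a' i * d := by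
      intro d i hi
      by_cases hii : i = i₀
      · rw [hii, h1, mul_one, one_mul]
      have := ih (s.erase i₀) (Finset.erase_ssubset hi₀) (fun i => d * a' i - a' i * d) (by
        intro y
        have h2 : ∑ i ∈ s, b i * y * (d * a' i - a' i * d) = 0 := by
          have h3 : ∀ i, b i * y * (d * a' i - a' i * d) =
              b i * (y * d) * a' i - b i * y * a' i * d := fun i => by noncomm_ring
          simp only [h3, Finset.sum_sub_distrib, ← Finset.sum_mul, ha', zero_mul, sub_zero]
        rw [← Finset.add_sum_erase _ _ hi₀, h1] at h2
        simpa using h2) i (Finset.mem_erase.2 ⟨hii, hi⟩)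
      exact sub_eq_zero.1 this
    have hmem : ∀ i ∈ s, ∃ f : F, algebraMap F D f = a' i := by
      intro i hi
      have : a' i ∈ Subalgebra.center F D := Subalgebra.mem_center_iff.2 fun d => hcent d i hi
      rw [Algebra.IsCentral.center_eq_bot] at this
      exact Algebra.mem_bot.1 this
    choose! g hg using hmem
    have h2 : ∑ i ∈ s, g i • b i = 0 := by
      rw [← ha' 1]
      refine Finset.sum_congr rfl fun i hi => ?_
      rw [Algebra.smul_def, Algebra.commutes, hg i hi, mul_one]
    have h3 := linearIndependent_iff'.1 hb s g h2 i₀ hi₀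
    have h4 := hg i₀ hi₀
    rw [h3, h1, map_zero] at h4
    exact zero_ne_one h4

lemma finiteDimensional_of_algHom [FiniteDimensional F D] {L : Type*} [Field L] [Algebra F L]
    (f : L →ₐ[F] D) : FiniteDimensional F L :=
  FiniteDimensional.of_injective f.toLinearMap f.toRingHom.injective

lemma finrank_mul_finrank_algHom [FiniteDimensional F D] {L : Type*} [Field L] [Algebra F L]
    (f : L →ₐ[F] D) :
    letI : Module L D := Module.compHom D f.toRingHom
    Module.Finite L D ∧ Module.finrank F L * Module.finrank L D = Module.finrank F D := by
  let _ : Module L D := Module.compHom D f.toRingHom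
  have : IsScalarTower F L D := ⟨fun a l d => by
    change f (a • l) * d = a • (f l * d)
    rw [map_smul, smul_mul_assoc]⟩
  have := finiteDimensional_of_algHom f
  exact ⟨Module.Finite.of_restrictScalars_finite F L D, Module.finrank_mul_finrank F L D⟩

/-- A subfield of a central division algebra has degree at most the square root of the
dimension. -/
lemma finrank_sq_le [FiniteDimensional F D] [Algebra.IsCentral F D] {L : Type*} [Field L]
    [Algebra F L] (f : L →ₐ[F] D) : Module.finrank F L ^ 2 ≤ Module.finrank F D := by
  let _ : Module L D := Module.compHom D f.toRingHom
  have := finiteDimensional_of_algHom f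
  obtain ⟨hfin, hrank⟩ := finrank_mul_finrank_algHom f
  let b := Module.finBasis F L
  let y := Module.finBasis L D
  set m := Module.finrank F L
  set r := Module.finrank L D
  have hb : LinearIndependent F (fun i => f (b i)) :=
    b.linearIndependent.map' f.toLinearMap (LinearMap.ker_eq_bot.2 f.toRingHom.injective)
  let T : (Fin m → D) →ₗ[F] (Fin r → D) :=
    { toFun := fun a j => ∑ i, f (b i) * y j * a i
      map_add' := fun a a' => by
        ext j; simp only [Pi.add_apply, mul_add, Finset.sum_add_distrib]
      map_smul' := fun c a => by
        ext j; simp [Finset.smul_sum] }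
  -- L is commutative, so scalars from L move past the f(b_i), and vanishing at an L-basis y of D
  -- implies vanishing at every d.
  have hT : Function.Injective T := by
    rw [injective_iff_map_eq_zero]
    intro a ha
    have h0 : ∀ d, ∑ i, f (b i) * d * a i = 0 := by
      intro d
      have h1 : ∀ j, ∑ i, f (b i) * y j * a i = 0 := fun j => congrFun ha j
      rw [← y.sum_repr d]
      have h2 : ∀ i, f (b i) * (∑ j, y.repr d j • y j) * a i =
          ∑ j, f (y.repr d j) * (f (b i) * y j * a i) := by
        intro i
        rw [Finset.mul_sum, Finset.sum_mul]
        refine Finset.sum_congr rfl fun j _ => ?_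
        change f (b i) * (f (y.repr d j) * y j) * a i = _
        rw [← mul_assoc, ← map_mul, mul_comm, map_mul]
        simp only [mul_assoc]
      simp only [h2]
      rw [Finset.sum_comm]
      simp only [← Finset.mul_sum, h1, mul_zero, Finset.sum_const_zero]
    funext i
    exact eq_zero_of_forall_sum_mul_mul_eq_zero hb Finset.univ a h0 i (Finset.mem_univ i)
  have h1 := LinearMap.finrank_le_finrank_of_injective hT
  rw [Module.finrank_pi_fintype, Module.finrank_pi_fintype] at h1
  simp only [Finset.sum_const, Finset.card_univ, Fintype.card_fin, smul_eq_mul] at h1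
  have hD : 0 < Module.finrank F D := Module.finrank_pos
  have h2 : m ≤ r := Nat.le_of_mul_le_mul_right h1 hD
  rw [← hrank, sq]
  exact Nat.mul_le_mul_left m h2

/-- A commutative subalgebra of a finite dimensional division algebra is a field. -/
noncomputable abbrev subalgebraField [FiniteDimensional F D] (K : Subalgebra F D)
    (hK : ∀ x ∈ K, ∀ y ∈ K, x * y = y * x) : Field K :=
  letI : CommRing K := { K.toRing with mul_comm := fun x y => Subtype.ext (hK x x.2 y y.2) }
  haveI : IsDomain K := inferInstance
  fieldOfFiniteDimensional F K

lemma finrank_subalgebra_sq_le [FiniteDimensional F D] [Algebra.IsCentral F D]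
    (K : Subalgebra F D) (hK : ∀ x ∈ K, ∀ y ∈ K, x * y = y * x) :
    Module.finrank F K ^ 2 ≤ Module.finrank F D := by
  let _ := subalgebraField K hK
  exact finrank_sq_le K.val

lemma adjoin_singleton_comm (x : D) :
    ∀ y ∈ Algebra.adjoin F {x}, ∀ z ∈ Algebra.adjoin F {x}, y * z = z * y := fun y hy z hz =>
  congrArg Subtype.val ((Algebra.isMulCommutative_adjoin F (s := {x}) (by simp)).is_comm.comm
    ⟨y, hy⟩ ⟨z, hz⟩)

end Centralizer

/-! ### Recognizing cyclic algebras of prime degree. -/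

section Cyclic

/-- The order of σ is the degree of L over a fixed field, hence divides p and equals p, which
already bounds the number of automorphisms. -/
lemma galois_of_finrank_prime {F L : Type*} [Field F] [Field L] [Algebra F L] {p : ℕ}
    (hp : p.Prime) (hL : Module.finrank F L = p) (σ : L ≃ₐ[F] L) (hσ : σ ≠ 1) :
    IsGalois F L ∧ (∀ τ : L ≃ₐ[F] L, τ ∈ Subgroup.zpowers σ) ∧ σ ^ p = 1 := by
  have hfin : FiniteDimensional F L := Module.finite_of_finrank_pos (hL ▸ hp.pos)
  let H := Subgroup.zpowers σ
  have h1 : Module.finrank (IntermediateField.fixedField H) L = Nat.card H :=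
    IntermediateField.finrank_fixedField_eq_card H
  have h2 := Module.finrank_mul_finrank F (IntermediateField.fixedField H) L
  rw [h1, hL] at h2
  have h3 : Nat.card H ≠ 1 := by
    intro h
    rw [Subgroup.card_eq_one, Subgroup.zpowers_eq_bot] at h
    exact hσ h
  have h4 : Nat.card H = p := ((hp.dvd_iff_eq h3).1 (Dvd.intro_left _ h2)).symm
  have h5 : Nat.card (L ≃ₐ[F] L) = p := by
    refine le_antisymm ?_ (h4 ▸ Subgroup.card_le_card_group H)
    rw [← hL, Nat.card_eq_fintype_card]
    exact AlgEquiv.card_le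
  have h6 : H = ⊤ := Subgroup.eq_top_of_card_eq H (h4.trans h5.symm)
  refine ⟨IsGalois.of_card_aut_eq_finrank F L (h5.trans hL.symm), fun τ => ?_, ?_⟩
  · change τ ∈ H
    rw [h6]; trivial
  · rw [← h5]; exact pow_card_eq_one'

variable {F : Type*} [Field F] {D : Type u} [DivisionRing D] [Algebra F D]

/-- A subfield normalized but not centralized by `x` exhibits a division algebra of prime degree
as a cyclic algebra. -/
theorem cyclic_of_normalizes [FiniteDimensional F D] [Algebra.IsCentral F D] {p : ℕ}
    (hp : p.Prime) (hD : Module.finrank F D = p ^ 2) {L : Type u} [Field L] [Algebra F L]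
    (f : L →ₐ[F] D) (x : D) (hx : ∀ l, ∃ l', x * f l = f l' * x) (l₀ : L)
    (hl₀ : x * f l₀ ≠ f l₀ * x) :
    IsCyclicGalois F L ∧ IsCyclicAlgebra F D p ∧ x ^ p ∈ Subring.center D := by
  have hfin := finiteDimensional_of_algHom f
  have hinj : Function.Injective f := f.toRingHom.injective
  have hx0 : x ≠ 0 := by rintro rfl; simp at hl₀
  choose s hs using hx
  have hcanc : ∀ {a b : L}, f a * x = f b * x → a = b := fun h =>
    hinj (mul_right_cancel₀ hx0 h)
  let s' : L →ₐ[F] L :=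
    { toFun := s
      map_one' := hcanc (by rw [← hs]; simp)
      map_mul' := fun a b => hcanc (by
        rw [← hs, map_mul, map_mul, mul_assoc, ← hs, ← mul_assoc, ← mul_assoc, hs])
      map_zero' := hcanc (by rw [← hs]; simp)
      map_add' := fun a b => hcanc (by rw [← hs, map_add, map_add, mul_add, hs, hs, add_mul])
      commutes' := fun r => hcanc (by rw [← hs, f.commutes, Algebra.commutes]) }
  let σ : L ≃ₐ[F] L := AlgEquiv.ofBijective s' s'.bijective
  have hσ : ∀ l, x * f l = f (σ l) * x := hs
  have hσ1 : σ l₀ ≠ l₀ := fun h => hl₀ (by rw [hσ, h])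
  have hσ1' : σ ≠ 1 := fun h => hσ1 (by rw [h]; rfl)
  let _ : Module L D := Module.compHom D f.toRingHom
  obtain ⟨hfinLD, hrank⟩ := finrank_mul_finrank_algHom f
  -- The degree divides p², its square is at most p², and it is not 1 because σ moves l₀.
  have hL : Module.finrank F L = p := by
    have h1 := finrank_sq_le f
    rw [hD] at h1
    have h2 : Module.finrank F L ∣ p ^ 2 := hD ▸ Dvd.intro _ hrank
    obtain ⟨k, hk, hk'⟩ := (Nat.dvd_prime_pow hp).1 h2
    have h3 : Module.finrank F L ≠ 1 := by
      intro h
      have h4 : (⊥ : Subalgebra F L) = ⊤ := Subalgebra.bot_eq_top_of_finrank_eq_one h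
      have h5 : l₀ ∈ (⊥ : Subalgebra F L) := h4 ▸ Algebra.mem_top
      obtain ⟨a, rfl⟩ := Algebra.mem_bot.1 h5
      exact hσ1 (σ.commutes a)
    have h6 : k ≠ 0 := by rintro rfl; exact h3 (by simpa using hk')
    have h7 : k ≠ 2 := by
      rintro rfl
      rw [hk', ← pow_mul] at h1
      have := (Nat.pow_le_pow_iff_right hp.one_lt).1 h1
      omega
    have h8 : k = 1 := by omega
    simpa [h8] using hk'
  have hLD : Module.finrank L D = p := by
    rw [hL, hD, sq] at hrank
    exact Nat.eq_of_mul_eq_mul_left hp.pos hrank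
  obtain ⟨hgal, hgen, hσp⟩ := galois_of_finrank_prime hp hL σ hσ1'
  have hpow : ∀ (j : ℕ) l, x ^ j * f l = f ((σ ^ j) l) * x ^ j := by
    intro j
    induction j with
    | zero => intro l; simp
    | succ j ih =>
      intro l
      rw [pow_succ, mul_assoc, hσ, ← mul_assoc, ih, mul_assoc, pow_succ]
      rfl
  have hinjσ : Function.Injective fun j : Fin p => (σ ^ (j : ℕ)) l₀ := by
    have key : ∀ a b : ℕ, a < b → b < p → (σ ^ a) l₀ ≠ (σ ^ b) l₀ := by
      intro a b hab hb h
      have h1 : (σ ^ (b - a)) l₀ = l₀ := by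
        rw [← Nat.sub_add_cancel hab.le, Nat.add_comm, pow_add, AlgEquiv.mul_apply] at h
        exact ((σ ^ a).injective h).symm
      have hst : σ ^ (b - a) ∈ MulAction.stabilizer (L ≃ₐ[F] L) l₀ := h1
      have hcop : (b - a).Coprime p :=
        ((hp.coprime_iff_not_dvd).2 (Nat.not_dvd_of_pos_of_lt (by omega) (by omega))).symm
      have : Fact p.Prime := ⟨hp⟩
      have horder : orderOf σ = p := orderOf_eq_prime hσp hσ1'
      obtain ⟨m, hm⟩ := exists_pow_eq_self_of_coprime (x := σ) (n := b - a) (by rwa [horder])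
      have := (MulAction.stabilizer (L ≃ₐ[F] L) l₀).pow_mem hst m
      rw [hm] at this
      exact hσ1 this
    intro a b hab
    rcases lt_trichotomy (a : ℕ) b with h | h | h
    · exact absurd hab (key a b h b.2)
    · exact Fin.ext h
    · exact absurd hab.symm (key b a h a.2)
  -- Right multiplication by f(l₀) is linear over L acting on the left; the powers of x are
  -- eigenvectors with the distinct eigenvalues σ^j(l₀), hence independent.
  let T : Module.End L D :=
    { toFun := fun d => d * f l₀
      map_add' := fun a b => add_mul _ _ _
      map_smul' := fun c d => mul_assoc (f c) d (f l₀) }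
  have hli : LinearIndependent L fun j : Fin p => x ^ (j : ℕ) :=
    Module.End.eigenvectors_linearIndependent' T _ hinjσ _ fun j =>
      ⟨Module.End.mem_eigenspace_iff.2 (hpow j l₀), pow_ne_zero _ hx0⟩
  have hspan := hli.span_eq_top_of_card_eq_finrank' (by rw [Fintype.card_fin, hLD])
  have hbij : Function.Bijective fun c : Fin p → L => ∑ j : Fin p, f (c j) * x ^ (j : ℕ) := by
    constructor
    · exact linearIndependent_iff_injective_fintypeLinearCombination.1 hli
    · intro d
      have hd : d ∈ Submodule.span L (Set.range fun j : Fin p => x ^ (j : ℕ)) :=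
        hspan ▸ Submodule.mem_top
      exact (Submodule.mem_span_range_iff_exists_fun L).1 hd
  have hcent : x ^ p ∈ Subring.center D := by
    rw [Subring.mem_center_iff]
    intro d
    obtain ⟨c, rfl⟩ := hbij.2 d
    simp only [Finset.sum_mul, Finset.mul_sum]
    refine Finset.sum_congr rfl fun j _ => ?_
    rw [← mul_assoc, hpow, hσp, mul_assoc, mul_assoc, ← pow_add, ← pow_add, add_comm]
    rfl
  obtain ⟨a, ha⟩ : ∃ a, algebraMap F D a = x ^ p := by
    have : x ^ p ∈ Subalgebra.center F D := hcent
    rw [Algebra.IsCentral.center_eq_bot] at this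
    exact Algebra.mem_bot.1 this
  refine ⟨⟨hfin, hgal, ⟨σ, hgen⟩⟩, ⟨L, _, _, f, σ, x, a, hfin, hgal, hL, hgen, ?_, ha.symm, hσ, hbij⟩,
    hcent⟩
  rintro rfl
  rw [map_zero] at ha
  exact pow_ne_zero _ hx0 ha.symm

/-- An element `x` that is not central but whose `p`-th power is central conjugates some
element `s` to `s + 1`. -/
lemma exists_conj_eq_add_one {p : ℕ} [Fact p.Prime] [CharP F p] {x d : D} (hd : ⁅x, d⁆ ≠ 0)
    (hx : ∀ y : D, ⁅x ^ p, y⁆ = 0) : ∃ s, x * s = (s + 1) * x := by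
  classical
  have hnil : ∃ n, innerDer F x ^ n = 0 := ⟨p, by
    rw [innerDer_pow_char]; ext y; exact hx y⟩
  let n := Nat.find hnil
  have hn : innerDer F x ^ n = 0 := Nat.find_spec hnil
  have hn2 : 2 ≤ n := by
    by_contra! h
    have h1 : innerDer F x = 0 := by
      interval_cases n
      · rw [pow_zero] at hn
        rw [← mul_one (innerDer F x), hn, mul_zero]
      · simpa using hn
    exact hd (by rw [← innerDer_apply (F := F), h1]; rfl)
  have hn1 : innerDer F x ^ (n - 1) ≠ 0 := Nat.find_min hnil (by omega)
  obtain ⟨y₀, hy₀⟩ : ∃ y, (innerDer F x ^ (n - 1)) y ≠ 0 := by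
    by_contra! h
    exact hn1 (LinearMap.ext h)
  -- With ad(x)^n = 0 and n minimal, c = [x,y] is nonzero and commutes with x, so s = yc⁻¹x
  -- satisfies xs = (c + yx)c⁻¹x = (s + 1)x.
  let y := (innerDer F x ^ (n - 2)) y₀
  have h1 : ⁅x, y⁆ = (innerDer F x ^ (n - 1)) y₀ := by
    rw [show n - 1 = n - 2 + 1 by omega, pow_succ']
    rfl
  have h2 : ⁅x, ⁅x, y⁆⁆ = 0 := by
    rw [h1, ← innerDer_apply (F := F), ← Module.End.mul_apply, ← pow_succ',
      show n - 1 + 1 = n by omega, hn]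
    rfl
  set c := ⁅x, y⁆ with hc
  have hc0 : c ≠ 0 := h1 ▸ hy₀
  have hxc : x * c = c * x := sub_eq_zero.1 h2
  have hxc' : x * c⁻¹ = c⁻¹ * x := (Commute.inv_right₀ hxc)
  have hxy : x * y = c + y * x := by rw [hc, Ring.lie_def]; abel
  refine ⟨y * c⁻¹ * x, ?_⟩
  rw [← mul_assoc, ← mul_assoc, hxy, add_mul, add_mul, mul_inv_cancel₀ hc0, one_mul, add_mul,
    one_mul, mul_assoc y x, hxc', ← mul_assoc, add_comm]

/-- Conjugation by x sends s to s + 1, so x normalizes F(s) without centralizing it. -/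
theorem isCyclicAlgebra_of_pow_central [FiniteDimensional F D] [Algebra.IsCentral F D] {p : ℕ}
    [hp : Fact p.Prime] [CharP F p] (hD : Module.finrank F D = p ^ 2) {x d : D} (hd : ⁅x, d⁆ ≠ 0)
    (hx : ∀ y : D, ⁅x ^ p, y⁆ = 0) : IsCyclicAlgebra F D p := by
  obtain ⟨s, hs⟩ := exists_conj_eq_add_one (F := F) hd hx
  let K := Algebra.adjoin F {s}
  have hK := adjoin_singleton_comm (F := F) s
  let _ := subalgebraField K hK
  have hx0 : x ≠ 0 := by rintro rfl; simp [Ring.lie_def] at hd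
  refine (cyclic_of_normalizes hp.out hD K.val x ?_ ⟨s, Algebra.self_mem_adjoin_singleton F s⟩
    ?_).2.1
  · rintro ⟨l, hl⟩
    suffices ∃ l' ∈ K, x * l = l' * x by
      obtain ⟨l', h1, h2⟩ := this
      exact ⟨⟨l', h1⟩, h2⟩
    induction hl using Algebra.adjoin_induction with
    | mem y hy =>
      rw [Set.mem_singleton_iff] at hy
      subst hy
      exact ⟨y + 1, K.add_mem (Algebra.self_mem_adjoin_singleton F y) K.one_mem, hs⟩
    | algebraMap r => exact ⟨algebraMap F D r, K.algebraMap_mem r, (Algebra.commutes r x).symm⟩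
    | add a b _ _ ha hb =>
      obtain ⟨a', ha, ha'⟩ := ha
      obtain ⟨b', hb, hb'⟩ := hb
      exact ⟨a' + b', K.add_mem ha hb, by rw [mul_add, ha', hb', add_mul]⟩
    | mul a b _ _ ha hb =>
      obtain ⟨a', ha, ha'⟩ := ha
      obtain ⟨b', hb, hb'⟩ := hb
      exact ⟨a' * b', K.mul_mem ha hb, by rw [← mul_assoc, ha', mul_assoc, hb', mul_assoc]⟩
  · change x * s ≠ s * x
    rw [hs, add_mul, one_mul]
    simpa using hx0

end Cyclic

end ValuedDivision

namespace ValuedDivision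

/-! ### Deforming coefficient fields in characteristic p. -/

section CoefficientField

open Polynomial IntermediateField

lemma minpoly_eq_X_pow_sub_C {E K : Type*} [Field E] [Field K] [Algebra E K] {p : ℕ}
    [hp : Fact p.Prime] [CharP K p] {c : K} {γ : E} (hγ : c ^ p = algebraMap E K γ)
    (hc : c ∉ (algebraMap E K).range) : minpoly E c = X ^ p - C γ := by
  have hirr : Irreducible (X ^ p - C γ) := X_pow_sub_C_irreducible_of_prime hp.out (by
    rintro b rfl
    rw [map_pow] at hγ
    exact hc ⟨b, (frobenius_inj K p hγ).symm⟩)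
  exact (minpoly.eq_of_irreducible_of_monic hirr (by simp [hγ])
    (monic_X_pow_sub_C γ hp.out.ne_zero)).symm

lemma exists_ringHom_extend {E K S : Type*} [Field E] [Field K] [Algebra E K] [CommRing S] {c : K}
    (hc : IsIntegral E c) (htop : E⟮c⟯ = ⊤) (ψ : E →+* S) (ε : S)
    (h : (minpoly E c).eval₂ ψ ε = 0) :
    ∃ ψ' : K →+* S, (∀ a, ψ' (algebraMap E K a) = ψ a) ∧ ψ' c = ε := by
  let _ : Algebra E S := ψ.toAlgebra
  let pb := (adjoin.powerBasis hc).map ((equivOfEq htop).trans topEquiv)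
  have hgen : pb.gen = c := rfl
  have h' : aeval ε (minpoly E pb.gen) = 0 := by rw [hgen]; exact h
  refine ⟨(pb.lift ε h' : K →+* S), fun a => (pb.lift ε h').commutes a, ?_⟩
  have := pb.lift_gen ε h'
  rwa [hgen] at this

variable {k : Type*} [Field k] (p : ℕ) [hp : Fact p.Prime] [CharP k p]

/-- A subfield `K` of a field of characteristic `p` is generated by any element `c` that is not a
`p`-th power in `K` over a suitable subfield containing all `p`-th powers but not `c`. -/
lemma exists_pow_complement (K : Subfield k) (c : k) (hc : c ∈ K) (hcp : ∀ y ∈ K, y ^ p ≠ c) :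
    ∃ E : Subfield k, E ≤ K ∧ (∀ y ∈ K, y ^ p ∈ E) ∧ c ∉ E ∧
      ∀ M : Subfield k, E ≤ M → c ∈ M → K ≤ M := by
  let s : Set (Subfield k) := {E | E ≤ K ∧ (∀ y ∈ K, y ^ p ∈ E) ∧ c ∉ E}
  obtain ⟨E, -, hE⟩ := zorn_le_nonempty₀ s (by
    intro C hCs hC y hy
    have hdir := hC.directedOn
    refine ⟨sSup C, ⟨sSup_le fun E hE => (hCs hE).1, fun z hz => ?_, fun h => ?_⟩,
      fun z hz => le_sSup hz⟩
    · exact (le_sSup hy : y ≤ sSup C) ((hCs hy).2.1 z hz)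
    · obtain ⟨E, hE, hcE⟩ := (Subfield.mem_sSup_of_directedOn ⟨y, hy⟩ hdir).1 h
      exact (hCs hE).2.2 hcE) (K.map (frobenius k p)) (by
    refine ⟨?_, fun y hy => ⟨y, hy, rfl⟩, ?_⟩
    · rintro _ ⟨y, hy, rfl⟩
      exact K.pow_mem hy p
    · rintro ⟨y, hy, h⟩
      exact hcp y hy h)
  obtain ⟨⟨hEK, hpow, hcE⟩, hmax⟩ := hE
  have hdeg : ∀ y ∈ K, y ∉ E → Module.finrank E E⟮y⟯ = p := by
    intro y hy hyE
    have hmin : minpoly E y = X ^ p - C ⟨y ^ p, hpow y hy⟩ :=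
      minpoly_eq_X_pow_sub_C rfl (by rintro ⟨e, he⟩; exact hyE (he ▸ e.2))
    have hInt : IsIntegral E y := by
      by_contra h
      rw [minpoly.eq_zero h] at hmin
      exact (monic_X_pow_sub_C _ hp.out.ne_zero).ne_zero hmin.symm
    rw [adjoin.finrank hInt, hmin, natDegree_X_pow_sub_C]
  refine ⟨E, hEK, hpow, hcE, fun M hEM hcM y hy => ?_⟩
  by_cases hyE : y ∈ E
  · exact hEM hyE
  have hle : E ≤ E⟮y⟯.toSubfield := fun e he => E⟮y⟯.algebraMap_mem ⟨e, he⟩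
  have hyK : E⟮y⟯.toSubfield ≤ K := by
    have : E⟮y⟯ ≤ Subfield.extendScalars hEK := by
      rw [adjoin_simple_le_iff]; exact hy
    exact this
  -- Maximality of E forces c into E(y). Both E(c) and E(y) have degree p over E, so they coincide.
  have hcy : c ∈ E⟮y⟯ := by
    by_contra h
    have := hmax (y := E⟮y⟯.toSubfield) ⟨hyK, fun z hz => hle (hpow z hz), h⟩ hle
    exact hyE (this (mem_adjoin_simple_self E y))
  have hfin : FiniteDimensional E E⟮y⟯ :=
    Module.finite_of_finrank_pos (by rw [hdeg y hy hyE]; exact hp.out.pos)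
  have heq : E⟮c⟯ = E⟮y⟯ := by
    refine eq_of_le_of_finrank_eq ?_ ?_
    · rwa [adjoin_simple_le_iff]
    · rw [hdeg y hy hyE, hdeg c hc hcE]
  have hyc : y ∈ E⟮c⟯ := heq ▸ mem_adjoin_simple_self E y
  have : E⟮c⟯ ≤ Subfield.extendScalars hEM := by
    rw [adjoin_simple_le_iff]; exact hcM
  exact this hyc

/-- A descending tower of subfields in which the powers `c ^ p ^ n` are generators. -/
structure IsPowTower (c : k) (E : ℕ → Subfield k) : Prop where
  zero : E 0 = ⊤
  le : ∀ n, E (n + 1) ≤ E n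
  mem : ∀ n, c ^ p ^ n ∈ E n
  notMem : ∀ n, c ^ p ^ n ∉ E (n + 1)
  gen : ∀ n (M : Subfield k), E (n + 1) ≤ M → c ^ p ^ n ∈ M → E n ≤ M

/-- The construction continues because c^(p^(n+1)) = y^p with y in `E (n + 1)` would put c^(p^n) = y
there, by injectivity of Frobenius. -/
lemma exists_isPowTower (c : k) (hc : ∀ y : k, y ^ p ≠ c) : ∃ E, IsPowTower p c E := by
  obtain ⟨E, hE, hR⟩ := exists_seq_of_step
    (fun n (K : Subfield k) => (n = 0 → K = ⊤) ∧ c ^ p ^ n ∈ K ∧ ∀ y ∈ K, y ^ p ≠ c ^ p ^ n)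
    (fun n K E => E ≤ K ∧ c ^ p ^ n ∉ E ∧ ∀ M : Subfield k, E ≤ M → c ^ p ^ n ∈ M → K ≤ M)
    ⊤ ⟨fun _ => rfl, by simp, fun y _ => by simpa using hc y⟩ (by
      rintro n K ⟨-, h1, h2⟩
      obtain ⟨E, hEK, hpow, hcE, hgen⟩ := exists_pow_complement p K _ h1 h2
      have e : c ^ p ^ (n + 1) = (c ^ p ^ n) ^ p := by rw [← pow_mul, pow_succ]
      refine ⟨E, ⟨by simp, by rw [e]; exact hpow _ h1, fun y hy h => ?_⟩, hEK, hcE, hgen⟩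
      rw [e] at h
      exact hcE (frobenius_inj k p h ▸ hy))
  exact ⟨E, (hE 0).1 rfl, fun n => (hR n).1, fun n => (hE n).2.1, fun n => (hR n).2.1,
    fun n => (hR n).2.2⟩

variable {p}

omit hp [CharP k p] in
lemma IsPowTower.le_of_le {c : k} {E : ℕ → Subfield k} (hE : IsPowTower p c E) {M : Subfield k}
    (hc : c ∈ M) (n : ℕ) (h : E n ≤ M) : M = ⊤ := by
  induction n with
  | zero => rwa [hE.zero, top_le_iff] at h
  | succ n ih => exact ih (hE.gen n M h (pow_mem hc _))

/-- Each floor is a purely inseparable simple extension with minimal polynomial X^p - c^(p^(n+1)),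
so sending the generator to e^(p^n) is the only condition when climbing one floor. -/
lemma IsPowTower.exists_extend {c : k} {E : ℕ → Subfield k} (hE : IsPowTower p c E)
    {S : Type*} [CommRing S] (n : ℕ) (ψ : E n →+* S) (e : S)
    (h : ψ ⟨c ^ p ^ n, hE.mem n⟩ = e ^ p ^ n) :
    ∃ ψ' : k →+* S, (∀ y : E n, ψ' y = ψ y) ∧ ψ' c = e := by
  induction n with
  | zero =>
    have h0 : ∀ y : k, y ∈ E 0 := fun y => hE.zero ▸ Subfield.mem_top y
    let j : k →+* E 0 := (RingHom.id k).codRestrict (E 0) h0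
    refine ⟨ψ.comp j, fun y => rfl, ?_⟩
    have h' : e = e ^ p ^ 0 := by simp
    rw [h', ← h]
    change ψ _ = ψ _
    congr 1
    apply Subtype.ext
    simp [j]
  | succ n ih =>
    let _ : Algebra (E (n + 1)) (E n) := (Subfield.inclusion (hE.le n)).toAlgebra
    let c' : E n := ⟨c ^ p ^ n, hE.mem n⟩
    let γ : E (n + 1) := ⟨c ^ p ^ (n + 1), hE.mem (n + 1)⟩
    have hγ : c' ^ p = algebraMap (E (n + 1)) (E n) γ := Subtype.ext (by
      change (c ^ p ^ n) ^ p = c ^ p ^ (n + 1)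
      rw [← pow_mul, pow_succ])
    have hmin : minpoly (E (n + 1)) c' = X ^ p - C γ :=
      minpoly_eq_X_pow_sub_C hγ (by
        rintro ⟨y, hy⟩
        have : (y : k) = c ^ p ^ n := congrArg Subtype.val hy
        exact hE.notMem n (this ▸ y.2))
    have hInt : IsIntegral (E (n + 1)) c' := by
      by_contra h
      rw [minpoly.eq_zero h] at hmin
      exact (monic_X_pow_sub_C _ hp.out.ne_zero).ne_zero hmin.symm
    have htop : (E (n + 1))⟮c'⟯ = ⊤ := by
      rw [eq_top_iff]
      intro y _
      have := hE.gen n ((E (n + 1))⟮c'⟯.toSubfield.map (E n).subtype)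
        (fun a ha => ⟨⟨a, hE.le n ha⟩, (E (n + 1))⟮c'⟯.algebraMap_mem ⟨a, ha⟩, rfl⟩)
        ⟨c', mem_adjoin_simple_self _ c', rfl⟩ y.2
      obtain ⟨y', hy', h'⟩ := this
      rwa [← Subtype.ext h']
    obtain ⟨ψ', h1, h2⟩ := exists_ringHom_extend hInt htop ψ (e ^ p ^ n) (by
      rw [hmin, eval₂_sub, eval₂_pow, eval₂_X, eval₂_C, h, ← pow_mul, ← pow_succ, sub_self])
    obtain ⟨ψ'', h3, h4⟩ := ih ψ' h2
    exact ⟨ψ'', fun y => (h3 ⟨y, hE.le n y.2⟩).trans (h1 y), h4⟩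

/-- Deformation of a homomorphism from a field of characteristic `p` to a complete ring so that it
takes a prescribed value at an element which is not a `p`-th power. -/
theorem exists_ringHom_apply_eq {R : Type*} [CommRing R] [CharP R p] (I : Ideal R)
    [IsAdicComplete I R] (ι : k →+* R) {c : k} (hc : ∀ y : k, y ^ p ≠ c) {e : R}
    (he : e - ι c ∈ I) : ∃ s : k →+* R, s c = e ∧ ∀ a, s a - ι a ∈ I := by
  obtain ⟨E, hE⟩ := exists_isPowTower p c hc
  let π : (n : ℕ) → R →+* R ⧸ I ^ p ^ n := fun n => Ideal.Quotient.mk (I ^ p ^ n)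
  -- In characteristic p, e^(p^n) - ι(c)^(p^n) = (e - ι(c))^(p^n). So modulo I^(p^n) the map ι on `E
  -- n` is compatible with sending c to e.
  have hpow : ∀ n, π n (ι (c ^ p ^ n)) = π n e ^ p ^ n := by
    intro n
    have h1 := Ideal.pow_mem_pow he (p ^ n)
    rw [sub_pow_char_pow] at h1
    rw [map_pow ι, ← map_pow (π n)]
    exact (Ideal.Quotient.eq.2 h1).symm
  have hex : ∀ n, ∃ ψ : k →+* R ⧸ I ^ p ^ n, (∀ y : E n, ψ y = π n (ι y)) ∧ ψ c = π n e :=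
    fun n => hE.exists_extend n (((π n).comp ι).comp (E n).subtype) (π n e) (hpow n)
  choose f hf hfc using hex
  have hmono : StrictMono fun n => p ^ n := pow_right_strictMono₀ hp.out.one_lt
  have hcompat : ∀ {m}, (Ideal.Quotient.factorPow I (hmono.monotone m.le_succ)).comp (f (m + 1)) =
      f m := by
    intro m
    set φ := Ideal.Quotient.factorPow I (hmono.monotone m.le_succ)
    have hφ : ∀ r, φ (π (m + 1) r) = π m r := fun r => rfl
    -- Compatibility follows from uniqueness: both maps reduce to ι on `E m` and send c to e, and
    -- these generate k.
    have h1 : E m ≤ (φ.comp (f (m + 1))).eqLocusField ((π m).comp ι) := by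
      refine hE.gen m _ (fun y hy => ?_) ?_
      · change φ (f (m + 1) y) = π m (ι y)
        rw [hf (m + 1) ⟨y, hy⟩, hφ]
      · change φ (f (m + 1) (c ^ p ^ m)) = π m (ι (c ^ p ^ m))
        rw [map_pow, hfc, map_pow, hφ, hpow]
    have h2 : (φ.comp (f (m + 1))).eqLocusField (f m) = ⊤ := by
      refine hE.le_of_le ?_ m fun y hy => ?_
      · change φ (f (m + 1) c) = f m c
        rw [hfc, hfc, hφ]
      · exact (h1 hy).trans (hf m ⟨y, hy⟩).symm
    ext y
    exact (h2 ▸ Subfield.mem_top y : y ∈ (φ.comp (f (m + 1))).eqLocusField (f m))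
  let s := IsAdicComplete.StrictMono.liftRingHom I hmono f hcompat
  have hs : ∀ n a, π n (s a) = f n a := fun n a =>
    IsAdicComplete.StrictMono.mk_liftRingHom I hmono f hcompat a
  refine ⟨s, ?_, fun a => ?_⟩
  · rw [← sub_eq_zero]
    refine IsHausdorff.haus (I := I) inferInstance _ fun n => ?_
    rw [SModEq.zero, smul_eq_mul, Ideal.mul_top]
    refine Ideal.pow_le_pow_right hmono.le_apply ?_
    exact Ideal.Quotient.eq.1 ((hs n c).trans (hfc n))
  · have h0 : a ∈ E 0 := hE.zero ▸ Subfield.mem_top a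
    have := Ideal.Quotient.eq.1 ((hs 0 a).trans (hf 0 ⟨a, h0⟩))
    simpa using this

end CoefficientField

end ValuedDivision

namespace ValuedDivision

/-! ### The residue ring as a field. -/

section ResidueField

variable {D : Type*} [DivisionRing D] {w : Valuation D ℤᵐ⁰}

lemma residue_eq_iff {a b : w.integer} : residue w a = residue w b ↔ OrdGE w 1 ((a : D) - b) := by
  rw [← lt_one_iff_ordGE]
  exact Ideal.Quotient.eq

lemma residue_eq_zero_iff {a : w.integer} : residue w a = 0 ↔ OrdGE w 1 (a : D) := by
  rw [← lt_one_iff_ordGE]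
  exact Ideal.Quotient.eq_zero_iff_mem

lemma mem_integer_iff_ordGE {x : D} : x ∈ w.integer ↔ OrdGE w 0 x := by
  rw [Valuation.mem_integer_iff, le_one_iff_ordGE]

lemma isField_residueRing (hcomm : ∀ a b : ResidueRing w, a * b = b * a) :
    IsField (ResidueRing w) where
  exists_pair_ne := ⟨0, 1, fun h => by
    have h1 : residue w 0 = residue w 1 := by rw [map_zero, map_one]; exact h
    rw [residue_eq_iff] at h1
    exact not_ordGE_succ (ordEq_one (w := w)) (by simpa using h1.neg)⟩
  mul_comm := hcomm
  mul_inv_cancel {a} ha := by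
    obtain ⟨a, rfl⟩ := Ideal.Quotient.mk_surjective a
    have h0 : OrdEq w 0 (a : D) := (ordEq_or_ordGE (mem_integer_iff_ordGE.1 a.2)).resolve_right
      fun h => ha (residue_eq_zero_iff.2 h)
    refine ⟨residue w ⟨(a : D)⁻¹, mem_integer_iff_ordGE.2 (by simpa using h0.inv.ge)⟩, ?_⟩
    change residue w a * _ = 1
    rw [← map_mul, ← map_one (residue w)]
    congr 1
    exact Subtype.ext (mul_inv_cancel₀ h0.ne_zero)

/-- The field structure of a commutative residue ring. -/
noncomputable abbrev residueField (hcomm : ∀ a b : ResidueRing w, a * b = b * a) :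
    Field (ResidueRing w) := (isField_residueRing hcomm).toField

end ResidueField

/-! ### The residue extension of prime degree. -/

section ResidueExtension

variable {F : Type*} [Field F] {D : Type*} [DivisionRing D] [Algebra F D]
  (v : Valuation F ℤᵐ⁰) (w : Valuation D ℤᵐ⁰) [v.HasExtension w]

lemma residueRing_mul_comm (a b : ResidueRing v) : a * b = b * a := by
  obtain ⟨a, rfl⟩ := Ideal.Quotient.mk_surjective a
  obtain ⟨b, rfl⟩ := Ideal.Quotient.mk_surjective b
  rw [← map_mul, mul_comm, map_mul]

lemma residueMap_residue (a : v.integer) :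
    residueMap v w (residue v a) = residue w (algebraMap v.integer w.integer a) := rfl

variable {v w}

lemma ordGE_algebraMap_zero_iff {f : F} : OrdGE w 0 (algebraMap F D f) ↔ v f ≤ 1 := by
  rw [← le_one_iff_ordGE]
  exact Valuation.HasExtension.val_map_le_one_iff v w f

lemma ordGE_algebraMap_one_iff {f : F} : OrdGE w 1 (algebraMap F D f) ↔ v f < 1 := by
  rw [← lt_one_iff_ordGE]
  exact Valuation.HasExtension.val_map_lt_one_iff v w f

variable (v) in
lemma isResidueGen_iff {x : w.integer} :
    IsResidueGen F w (x : D) ↔ residue w x ∉ (residueMap v w).range := by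
  have hx : OrdGE w 0 (x : D) := mem_integer_iff_ordGE.1 x.2
  constructor
  · rintro ⟨-, h⟩ ⟨a, ha⟩
    obtain ⟨a, rfl⟩ := Ideal.Quotient.mk_surjective a
    exact h a ((residue_eq_iff (b := algebraMap v.integer w.integer a)).1 ha.symm)
  · refine fun h => ⟨hx, fun f hf => h ?_⟩
    have h0 : OrdGE w 0 (algebraMap F D f) := by
      simpa using hx.sub (hf.mono zero_le_one)
    refine ⟨residue v ⟨f, (ordGE_algebraMap_zero_iff (w := w)).1 h0⟩, ?_⟩
    rw [residueMap_residue]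
    exact (residue_eq_iff.2 hf).symm

variable {p : ℕ}

/-- The residue ring of `D` as an algebra over the residue field of `F`. -/
noncomputable abbrev residueAlgebra (v : Valuation F ℤᵐ⁰) (w : Valuation D ℤᵐ⁰) [v.HasExtension w]
    (hcomm : ∀ a b : ResidueRing w, a * b = b * a) :
    letI := residueField (residueRing_mul_comm v)
    letI := residueField hcomm
    Algebra (ResidueRing v) (ResidueRing w) :=
  letI := residueField (residueRing_mul_comm v)
  letI := residueField hcomm
  (residueMap v w).toAlgebra

lemma finrank_residueAlgebra (hcomm : ∀ a b : ResidueRing w, a * b = b * a) :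
    letI := residueField (residueRing_mul_comm v)
    letI := residueField hcomm
    letI := residueAlgebra v w hcomm
    Module.finrank (ResidueRing v) (ResidueRing w) = residueDegree v w := by
  rfl

section

variable (hp : p.Prime) (hcomm : ∀ a b : ResidueRing w, a * b = b * a)
  (hdeg : residueDegree v w = p)
include hp hcomm hdeg

open IntermediateField

lemma residue_adjoin_eq_top {a : ResidueRing w} (ha : a ∉ (residueMap v w).range) :
    letI := residueField (residueRing_mul_comm v)
    letI := residueField hcomm
    letI := residueAlgebra v w hcomm
    IsIntegral (ResidueRing v) a ∧ (ResidueRing v)⟮a⟯ = ⊤ ∧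
      (minpoly (ResidueRing v) a).natDegree = p := by
  let _ := residueField (residueRing_mul_comm v)
  let _ := residueField hcomm
  let _ := residueAlgebra v w hcomm
  have hrank : Module.finrank (ResidueRing v) (ResidueRing w) = p :=
    (finrank_residueAlgebra hcomm).trans hdeg
  have hfin : FiniteDimensional (ResidueRing v) (ResidueRing w) :=
    Module.finite_of_finrank_pos (hrank ▸ hp.pos)
  have hInt : IsIntegral (ResidueRing v) a := .of_finite _ _
  have htop : (ResidueRing v)⟮a⟯ = ⊤ := by
    have := IntermediateField.isSimpleOrder_of_finrank_prime (ResidueRing v) (ResidueRing w)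
      (hrank ▸ hp)
    refine (eq_bot_or_eq_top _).resolve_left fun h => ha ?_
    rw [adjoin_simple_eq_bot_iff, IntermediateField.mem_bot] at h
    exact h
  refine ⟨hInt, htop, ?_⟩
  rw [← adjoin.finrank hInt, htop, IntermediateField.finrank_top', hrank]

lemma exists_isResidueGen : ∃ x : D, IsResidueGen F w x := by
  let _ := residueField (residueRing_mul_comm v)
  let _ := residueField hcomm
  let _ := residueAlgebra v w hcomm
  have hrank : Module.finrank (ResidueRing v) (ResidueRing w) = p :=
    (finrank_residueAlgebra hcomm).trans hdeg
  by_contra! h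
  have hbot : (⊥ : Subalgebra (ResidueRing v) (ResidueRing w)) = ⊤ := by
    rw [eq_top_iff]
    intro a _
    obtain ⟨a, rfl⟩ := Ideal.Quotient.mk_surjective a
    have := h a
    rw [isResidueGen_iff v, not_not] at this
    exact Algebra.mem_bot.2 this
  rw [Subalgebra.bot_eq_top_iff_finrank_eq_one, hrank] at hbot
  exact hp.one_lt.ne' hbot

lemma residue_pow_independent {x : D} (hx : IsResidueGen F w x) (h : Fin p → F)
    (hInt : ∀ i, OrdGE w 0 (algebraMap F D (h i)))
    (hs : OrdGE w 1 (∑ i, algebraMap F D (h i) * x ^ (i : ℕ))) (i : Fin p) :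
    OrdGE w 1 (algebraMap F D (h i)) := by
  let _ := residueField (residueRing_mul_comm v)
  let _ := residueField hcomm
  let _ := residueAlgebra v w hcomm
  let X : w.integer := ⟨x, mem_integer_iff_ordGE.2 hx.1⟩
  obtain ⟨-, -, hnat⟩ := residue_adjoin_eq_top hp hcomm hdeg
    ((isResidueGen_iff v (x := X)).1 hx)
  have hli := linearIndependent_pow (K := ResidueRing v) (residue w X)
  rw [hnat] at hli
  let a : Fin p → v.integer := fun i => ⟨h i, (ordGE_algebraMap_zero_iff (w := w)).1 (hInt i)⟩
  have h0 : ∑ i, residue v (a i) • residue w X ^ (i : ℕ) = 0 := by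
    have h1 : residue w (∑ i, algebraMap v.integer w.integer (a i) * X ^ (i : ℕ)) = 0 := by
      rw [residue_eq_zero_iff]
      convert hs using 1
      simp only [AddSubmonoidClass.coe_finsetSum]
      rfl
    rw [map_sum] at h1
    rw [← h1]
    refine Finset.sum_congr rfl fun i _ => ?_
    rw [map_mul, map_pow, ← residueMap_residue]
    rfl
  have h2 := Fintype.linearIndependent_iff.1 hli _ h0 i
  rw [ordGE_algebraMap_one_iff (v := v), lt_one_iff_ordGE]
  exact residue_eq_zero_iff.1 h2

lemma residue_pow_spans {x y : D} (hx : IsResidueGen F w x) (hy : OrdGE w 0 y) :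
    ∃ h : Fin p → F, (∀ i, OrdGE w 0 (algebraMap F D (h i))) ∧
      OrdGE w 1 (y - ∑ i, algebraMap F D (h i) * x ^ (i : ℕ)) := by
  let _ := residueField (residueRing_mul_comm v)
  let _ := residueField hcomm
  let _ := residueAlgebra v w hcomm
  let X : w.integer := ⟨x, mem_integer_iff_ordGE.2 hx.1⟩
  let Y : w.integer := ⟨y, mem_integer_iff_ordGE.2 hy⟩
  obtain ⟨-, -, hnat⟩ := residue_adjoin_eq_top hp hcomm hdeg
    ((isResidueGen_iff v (x := X)).1 hx)
  have hli := linearIndependent_pow (K := ResidueRing v) (residue w X)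
  rw [hnat] at hli
  have hrank : Module.finrank (ResidueRing v) (ResidueRing w) = p :=
    (finrank_residueAlgebra hcomm).trans hdeg
  have hfin : FiniteDimensional (ResidueRing v) (ResidueRing w) :=
    Module.finite_of_finrank_pos (hrank ▸ hp.pos)
  have hspan := hli.span_eq_top_of_card_eq_finrank' (by rw [Fintype.card_fin, hrank])
  have hmem : residue w Y ∈ Submodule.span (ResidueRing v)
      (Set.range fun i : Fin p => residue w X ^ (i : ℕ)) := hspan ▸ Submodule.mem_top
  obtain ⟨c, hc⟩ := (Submodule.mem_span_range_iff_exists_fun (ResidueRing v)).1 hmem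
  have hlift : ∀ i, ∃ a : v.integer, residue v a = c i := fun i =>
    Ideal.Quotient.mk_surjective (c i)
  choose a ha using hlift
  refine ⟨fun i => a i, fun i => (ordGE_algebraMap_zero_iff (v := v)).2 (a i).2, ?_⟩
  have h1 : residue w Y = residue w (∑ i, algebraMap v.integer w.integer (a i) * X ^ (i : ℕ)) := by
    rw [← hc, map_sum]
    refine Finset.sum_congr rfl fun i _ => ?_
    rw [map_mul, map_pow, ← residueMap_residue, ha]
    rfl
  have h2 := residue_eq_iff.1 h1
  simp only [AddSubmonoidClass.coe_finsetSum] at h2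
  exact h2

end

end ResidueExtension

end ValuedDivision

namespace ValuedDivision

/-! ### A valuation basis: completeness, dimension and ramification. -/

section Orthogonal

variable {F : Type*} [Field F] {D : Type*} [DivisionRing D] [Algebra F D] {w : Valuation D ℤᵐ⁰}
  {p e : ℕ} {x z : D} {t : F}

/-- The combination of the products `x ^ i * z ^ j` with coefficients `f i j`. -/
def powCombination (F : Type*) [Field F] {D : Type*} [DivisionRing D] [Algebra F D] (p e : ℕ)
    (x z : D) : (Fin p → Fin e → F) →ₗ[F] D where
  toFun f := ∑ j : Fin e, (∑ i : Fin p, algebraMap F D (f i j) * x ^ (i : ℕ)) * z ^ (j : ℕ)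
  map_add' f g := by
    simp only [Pi.add_apply, map_add, add_mul, Finset.sum_add_distrib]
  map_smul' c f := by
    simp only [Pi.smul_apply, smul_eq_mul, map_mul, RingHom.id_apply, Algebra.smul_def,
      Finset.mul_sum, mul_assoc, Finset.sum_mul]

/-- `x` and `z` lift a generator of the residue extension and a generator of the value group,
where `t` has order `e`. -/
structure IsPowBasis (F : Type*) [Field F] {D : Type*} [DivisionRing D] [Algebra F D]
    (w : Valuation D ℤᵐ⁰) (p e : ℕ) (x z : D) (t : F) : Prop where
  ord_z : OrdEq w 1 z
  ord_t : OrdEq w e (algebraMap F D t)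
  e_pos : 0 < e
  ord_x : OrdGE w 0 x
  ord_F : ∀ f : F, f ≠ 0 → ∃ m : ℤ, OrdEq w (e * m) (algebraMap F D f)
  ind : ∀ h : Fin p → F, (∀ i, OrdGE w 0 (algebraMap F D (h i))) →
    OrdGE w 1 (∑ i, algebraMap F D (h i) * x ^ (i : ℕ)) → ∀ i, OrdGE w 1 (algebraMap F D (h i))
  span : ∀ y, OrdGE w 0 y → ∃ h : Fin p → F, (∀ i, OrdGE w 0 (algebraMap F D (h i))) ∧
    OrdGE w 1 (y - ∑ i, algebraMap F D (h i) * x ^ (i : ℕ))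

variable (B : IsPowBasis F w p e x z t)
include B

/-- After division by a coefficient of least order, residue independence makes the sum a unit. -/
lemma IsPowBasis.ordEq_sum (g : Fin p → F) (hg : ∃ i, g i ≠ 0) :
    ∃ m : ℤ, OrdEq w (e * m) (∑ i, algebraMap F D (g i) * x ^ (i : ℕ)) ∧
      ∀ i, OrdGE w (e * m) (algebraMap F D (g i)) := by
  obtain ⟨i₁, hi₁⟩ := hg
  obtain ⟨i₀, -, hmax⟩ := Finset.exists_max_image Finset.univ
    (fun i => w (algebraMap F D (g i))) ⟨i₁, Finset.mem_univ _⟩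
  have hi₀ : g i₀ ≠ 0 := by
    intro h0
    have := hmax i₁ (Finset.mem_univ _)
    rw [h0, map_zero, map_zero, le_zero_iff, w.zero_iff] at this
    exact hi₁ ((map_eq_zero _).1 this)
  obtain ⟨m, hm⟩ := B.ord_F _ hi₀
  have hge : ∀ i, OrdGE w (e * m) (algebraMap F D (g i)) := fun i =>
    (hmax i (Finset.mem_univ _)).trans hm.ge
  refine ⟨m, ?_, hge⟩
  let h : Fin p → F := fun i => (g i₀)⁻¹ * g i
  have hh : ∀ i, OrdGE w 0 (algebraMap F D (h i)) := fun i => by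
    have := hm.inv.ge.mul (hge i)
    simp only [h, map_mul, map_inv₀]
    exact this.mono (by omega)
  have hsum : ∑ i, algebraMap F D (g i) * x ^ (i : ℕ) =
      algebraMap F D (g i₀) * ∑ i, algebraMap F D (h i) * x ^ (i : ℕ) := by
    rw [Finset.mul_sum]
    refine Finset.sum_congr rfl fun i _ => ?_
    rw [← mul_assoc, ← map_mul, mul_inv_cancel_left₀ hi₀]
  have h1 : OrdGE w 0 (∑ i, algebraMap F D (h i) * x ^ (i : ℕ)) :=
    OrdGE.sum fun i _ => ((hh i).mul (B.ord_x.pow i)).mono (by simp)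
  have h2 : OrdEq w 0 (∑ i, algebraMap F D (h i) * x ^ (i : ℕ)) := by
    refine (ordEq_or_ordGE h1).resolve_right fun h3 => ?_
    have := B.ind h hh h3 i₀
    simp only [h, inv_mul_cancel₀ hi₀, map_one] at this
    exact not_ordGE_succ ordEq_one this
  rw [hsum]
  simpa using hm.mul h2

/-- The nonzero terms with different powers z^j have orders distinct mod e, so nothing cancels;
removing z^j with j < e costs less than e. -/
lemma IsPowBasis.ordGE_coeff {N : ℤ} {f : Fin p → Fin e → F}
    (hN : OrdGE w N (powCombination F p e x z f)) (i : Fin p) (j : Fin e) :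
    OrdGE w (N - e) (algebraMap F D (f i j)) := by
  classical
  let c : Fin e → D := fun j => ∑ i : Fin p, algebraMap F D (f i j) * x ^ (i : ℕ)
  by_cases hij : f i j = 0
  · rw [hij, map_zero]; exact ordGE_zero _
  have hnz : ∀ j, (∃ i, f i j ≠ 0) → ∃ m : ℤ, OrdEq w (e * m) (c j) ∧
      ∀ i, OrdGE w (e * m) (algebraMap F D (f i j)) := fun j hj => B.ordEq_sum _ hj
  have hz0 : ∀ j, (¬ ∃ i, f i j ≠ 0) → c j = 0 := by
    intro j hj
    push Not at hj
    simp [c, hj]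
  obtain ⟨j₀, -, hmax⟩ := Finset.exists_max_image Finset.univ
    (fun j => w (c j * z ^ (j : ℕ))) ⟨j, Finset.mem_univ _⟩
  obtain ⟨m, hm, hmi⟩ := hnz j ⟨i, hij⟩
  have hj : OrdEq w (e * m + j) (c j * z ^ (j : ℕ)) := by
    simpa using hm.mul (B.ord_z.pow j)
  have hj₀ : ∃ i, f i j₀ ≠ 0 := by
    by_contra h
    have := hmax j (Finset.mem_univ _)
    rw [hz0 j₀ h, zero_mul, map_zero, le_zero_iff, w.zero_iff] at this
    exact hj.ne_zero this
  obtain ⟨m₀, hm₀, -⟩ := hnz j₀ hj₀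
  have hord₀ : OrdEq w (e * m₀ + j₀) (c j₀ * z ^ (j₀ : ℕ)) := by
    simpa using hm₀.mul (B.ord_z.pow j₀)
  have hlt : ∀ j' ∈ Finset.univ \ {j₀}, w (c j' * z ^ (j' : ℕ)) < w (c j₀ * z ^ (j₀ : ℕ)) := by
    intro j' hj'
    have hne : j' ≠ j₀ := by simpa using hj'
    refine lt_of_le_of_ne (hmax j' (Finset.mem_univ _)) fun heq => ?_
    by_cases h : ∃ i, f i j' ≠ 0
    · obtain ⟨m', hm', -⟩ := hnz j' h
      have h1 : OrdEq w (e * m' + j') (c j' * z ^ (j' : ℕ)) := by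
        simpa using hm'.mul (B.ord_z.pow j')
      have h2 : OrdEq w (e * m₀ + j₀) (c j' * z ^ (j' : ℕ)) := heq.trans hord₀
      have h3 := h1.unique h2
      apply hne
      have h4 : ((j₀ : ℕ) : ℤ) % e = ((j' : ℕ) : ℤ) % e := by
        rw [← Int.add_mul_emod_self_left _ _ m₀, add_comm, h3, add_comm,
          Int.add_mul_emod_self_left]
      rw [Int.emod_eq_of_lt (by omega) (by exact_mod_cast j₀.2),
        Int.emod_eq_of_lt (by omega) (by exact_mod_cast j'.2)] at h4
      exact (Fin.ext (by exact_mod_cast h4)).symm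
    · rw [hz0 j' h, zero_mul, map_zero] at heq
      exact hord₀.ne_zero ((w.zero_iff).1 heq.symm)
  have hsum : OrdEq w (e * m₀ + j₀) (powCombination F p e x z f) :=
    (w.map_sum_eq_of_lt (Finset.mem_univ j₀) hlt).trans hord₀
  have h1 := hsum.le hN
  have h2 : OrdGE w (e * m₀ + j₀) (c j * z ^ (j : ℕ)) :=
    (hmax j (Finset.mem_univ _)).trans hord₀.ge
  have h3 := hj.le h2
  have := j.2
  exact (hmi i).mono (by omega)

lemma IsPowBasis.powCombination_injective :
    Function.Injective (powCombination F p e x z) := by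
  rw [injective_iff_map_eq_zero]
  intro f hf
  funext i j
  have : algebraMap F D (f i j) = 0 := eq_zero_of_forall_ordGE (w := w) fun n => by
    refine (B.ordGE_coeff (N := n + e) ?_ i j).mono (by omega)
    rw [hf]; exact ordGE_zero _
  exact (map_eq_zero _).1 this

lemma IsPowBasis.ordGE_powCombination {N : ℤ} {f : Fin p → Fin e → F}
    (hf : ∀ i j, OrdGE w N (algebraMap F D (f i j))) :
    OrdGE w N (powCombination F p e x z f) := by
  change OrdGE w N (∑ j : Fin e, (∑ i : Fin p, algebraMap F D (f i j) * x ^ (i : ℕ)) * z ^ (j : ℕ))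
  refine OrdGE.sum fun j _ => ?_
  have h1 : OrdGE w N (∑ i : Fin p, algebraMap F D (f i j) * x ^ (i : ℕ)) :=
    OrdGE.sum fun i _ => ((hf i j).mul (B.ord_x.pow i)).mono (by simp)
  exact (h1.mul (B.ord_z.pow j).ge).mono (by simp)

lemma IsPowBasis.exists_approx (N : ℤ) (y : D) :
    ∃ f, OrdGE w N (y - powCombination F p e x z f) := by
  obtain ⟨g, ⟨f, rfl⟩, hg⟩ := ValuedDivision.exists_approx (w := w) ⊤
    (powCombination F p e x z).range.toAddSubgroup le_top N (by
      intro y _ n _ hy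
      let j : Fin e := ⟨(n % e).toNat, by
        have := Int.emod_lt_of_pos n (b := e) (by exact_mod_cast B.e_pos)
        have := Int.emod_nonneg n (b := e) (by have := B.e_pos; omega)
        omega⟩
      have hjn : e * (n / e) + (j : ℕ) = n := by
        have := Int.emod_nonneg n (b := e) (by have := B.e_pos; omega)
        have h2 := Int.mul_ediv_add_emod n e
        simp only [j]
        omega
      let m := n / e
      have htm : OrdEq w (e * m) (algebraMap F D (t ^ m)) := by
        rw [map_zpow₀, mul_comm]; exact B.ord_t.zpow m
      have hzj : OrdEq w j (z ^ (j : ℕ)) := by simpa using B.ord_z.pow j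
      have hy₀ := (htm.inv.mul hy).mul hzj.inv
      rw [show -(e * m) + n + -((j : ℕ) : ℤ) = 0 by
        simp only [m]; linarith] at hy₀
      obtain ⟨h, hh, hh'⟩ := B.span _ hy₀.ge
      refine ⟨powCombination F p e x z fun i j' => if j' = j then t ^ m * h i else 0,
        ⟨_, rfl⟩, ?_⟩
      have e1 : powCombination F p e x z (fun i j' => if j' = j then t ^ m * h i else 0) =
          algebraMap F D (t ^ m) * (∑ i, algebraMap F D (h i) * x ^ (i : ℕ)) * z ^ (j : ℕ) := by
        change ∑ j' : Fin e, (∑ i : Fin p, algebraMap F D (if j' = j then t ^ m * h i else 0) *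
          x ^ (i : ℕ)) * z ^ (j' : ℕ) = _
        rw [Finset.sum_eq_single j]
        · simp only [if_true, map_mul, Finset.mul_sum, mul_assoc]
        · intro j' _ hj'
          simp [hj']
        · simp
      rw [e1]
      have e2 : y = algebraMap F D (t ^ m) *
          ((algebraMap F D (t ^ m))⁻¹ * y * (z ^ (j : ℕ))⁻¹) * z ^ (j : ℕ) := by
        rw [mul_assoc, inv_mul_cancel_right₀ hzj.ne_zero, mul_inv_cancel_left₀ htm.ne_zero]
      rw [e2, ← sub_mul, ← mul_sub]
      exact ((htm.ge.mul hh').mul hzj.ge).mono (by simp only [m]; linarith)) y trivial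
  exact ⟨f, hg⟩

variable (hF : ∀ d : ℕ → F, (∀ N : ℤ, ∃ M, ∀ n ≥ M, OrdGE w N (algebraMap F D (d (n + 1) - d n))) →
    ∃ f, ∀ N : ℤ, ∃ M, ∀ n ≥ M, OrdGE w N (algebraMap F D (f - d n)))
include hF

/-- By `IsPowBasis.ordGE_coeff` convergence can be checked on coordinates, which transfers
completeness from F. -/
lemma IsPowBasis.exists_limit (d : ℕ → Fin p → Fin e → F)
    (hd : ∀ N : ℤ, ∃ M, ∀ n ≥ M, OrdGE w N
      (powCombination F p e x z (d (n + 1)) - powCombination F p e x z (d n))) :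
    ∃ f, ∀ N : ℤ, ∃ M, ∀ n ≥ M, OrdGE w N
      (powCombination F p e x z f - powCombination F p e x z (d n)) := by
  have h1 : ∀ i j, ∃ f, ∀ N : ℤ, ∃ M, ∀ n ≥ M, OrdGE w N (algebraMap F D (f - d n i j)) := by
    intro i j
    refine hF (fun n => d n i j) fun N => ?_
    obtain ⟨M, hM⟩ := hd (N + e)
    refine ⟨M, fun n hn => ?_⟩
    have := hM n hn
    rw [← map_sub] at this
    exact (B.ordGE_coeff this i j).mono (by omega)
  choose f hf using h1
  refine ⟨f, fun N => ?_⟩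
  choose M hM using fun i j => hf i j N
  refine ⟨∑ i, ∑ j, M i j, fun n hn => ?_⟩
  rw [← map_sub]
  refine B.ordGE_powCombination fun i j => hM i j n (le_trans ?_ hn)
  exact (Finset.single_le_sum (f := fun j => M i j) (fun _ _ => Nat.zero_le _)
    (Finset.mem_univ j)).trans (Finset.single_le_sum (f := fun i => ∑ j, M i j)
      (fun _ _ => Nat.zero_le _) (Finset.mem_univ i))

lemma IsPowBasis.powCombination_surjective : Function.Surjective (powCombination F p e x z) := by
  intro y
  choose d hd using fun n : ℕ => B.exists_approx n y
  obtain ⟨f, hf⟩ := B.exists_limit hF d (by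
    intro N
    refine ⟨N.toNat, fun n hn => ?_⟩
    have := (((hd n).mono (m := N) (by omega)).sub ((hd (n + 1)).mono (m := N) (by push_cast; omega)))
    simpa using this)
  refine ⟨f, ?_⟩
  rw [← sub_eq_zero]
  refine eq_zero_of_forall_ordGE (w := w) fun N => ?_
  obtain ⟨M, hM⟩ := hf N
  have := (hM (N + M) (by omega)).sub ((hd (N + M)).mono (m := N) (by push_cast; omega))
  simpa using this

lemma IsPowBasis.isSeqComplete : IsSeqComplete w := by
  intro d hd
  choose g hg using fun n => B.powCombination_surjective hF (d n)
  obtain ⟨f, hf⟩ := B.exists_limit hF g (by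
    intro N
    simp only [hg]
    exact hd _ WithZero.exp_ne_zero)
  refine ⟨powCombination F p e x z f, fun γ hγ => ?_⟩
  obtain ⟨M, hM⟩ := hf (-WithZero.log γ)
  refine ⟨M, fun n hn => ?_⟩
  have := hM n hn
  rwa [hg, OrdGE, neg_neg, WithZero.exp_log hγ] at this

lemma IsPowBasis.finrank_eq : Module.finrank F D = p * e := by
  rw [← (LinearEquiv.ofBijective _
    ⟨B.powCombination_injective, B.powCombination_surjective hF⟩).finrank_eq]
  simp [Module.finrank_pi_fintype]

/-- F(x) and F(z) contain p and e independent powers, so p² and e² are both at most [D:F] = pe. -/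
lemma IsPowBasis.ramification_eq [FiniteDimensional F D] [Algebra.IsCentral F D] (hp : 0 < p) :
    e = p := by
  have hrank := B.finrank_eq hF
  have hinj := B.powCombination_injective
  have hpow : ∀ (y : D) (n : ℕ), LinearIndependent F (fun i : Fin n => y ^ (i : ℕ)) →
      n ^ 2 ≤ p * e := by
    intro y n hli
    rw [← hrank]
    let K := Algebra.adjoin F {y}
    have hy : y ∈ K := Algebra.self_mem_adjoin_singleton F y
    let g : Fin n → K := fun i => ⟨y ^ (i : ℕ), K.pow_mem hy _⟩
    have hg : LinearIndependent F g := LinearIndependent.of_comp K.val.toLinearMap hli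
    have h1 := hg.fintype_card_le_finrank
    rw [Fintype.card_fin] at h1
    exact (Nat.pow_le_pow_left h1 2).trans (finrank_subalgebra_sq_le K (adjoin_singleton_comm y))
  have he0 := B.e_pos
  have h1 : p ^ 2 ≤ p * e := by
    refine hpow x p (Fintype.linearIndependent_iff.2 fun g hg i => ?_)
    have := congrFun (congrFun (hinj (a₁ := fun i j => if (j : ℕ) = 0 then g i else 0) (a₂ := 0) (by
      rw [map_zero, ← hg]
      change ∑ j : Fin e, (∑ i : Fin p, algebraMap F D (if (j : ℕ) = 0 then g i else 0) *
        x ^ (i : ℕ)) * z ^ (j : ℕ) = _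
      rw [Finset.sum_eq_single ⟨0, he0⟩]
      · simp [Algebra.smul_def]
      · intro j _ hj
        have : (j : ℕ) ≠ 0 := fun h => hj (Fin.ext h)
        simp [this]
      · simp)) i) ⟨0, he0⟩
    simpa using this
  have h2 : e ^ 2 ≤ p * e := by
    refine hpow z e (Fintype.linearIndependent_iff.2 fun g hg j => ?_)
    have := congrFun (congrFun (hinj (a₁ := fun i j => if (i : ℕ) = 0 then g j else 0) (a₂ := 0) (by
      rw [map_zero, ← hg]
      change ∑ j : Fin e, (∑ i : Fin p, algebraMap F D (if (i : ℕ) = 0 then g j else 0) *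
        x ^ (i : ℕ)) * z ^ (j : ℕ) = _
      refine Finset.sum_congr rfl fun j _ => ?_
      rw [Finset.sum_eq_single ⟨0, hp⟩]
      · simp [Algebra.smul_def]
      · intro i _ hi
        have : (i : ℕ) ≠ 0 := fun h => hi (Fin.ext h)
        simp [this]
      · simp)) ⟨0, hp⟩) j
    simpa using this
  rw [sq] at h1 h2
  exact le_antisymm (Nat.le_of_mul_le_mul_right h2 he0) (Nat.le_of_mul_le_mul_left h1 hp)

end Orthogonal

end ValuedDivision

namespace ValuedDivision

/-! ### From the valuations to the numerical structure. -/

section Assembly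

variable {F : Type*} [Field F] {D : Type*} [DivisionRing D] [Algebra F D]
  {v : Valuation F ℤᵐ⁰} {w : Valuation D ℤᵐ⁰} [v.HasExtension w] {p : ℕ}

lemma ordEq_algebraMap {t f : F} {e : ℕ} {m : ℤ} (ht : v t = WithZero.exp (-1))
    (he : OrdEq w e (algebraMap F D t)) (hf : v f = WithZero.exp (-m)) :
    OrdEq w (e * m) (algebraMap F D f) := by
  have h1 : v f = v (t ^ m) := by
    rw [hf, map_zpow₀, ht, ← WithZero.exp_zsmul]
    simp
  have h2 := (Valuation.HasExtension.val_map_eq_iff v w f (t ^ m)).2 h1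
  have h3 := he.zpow m
  unfold OrdEq at *
  rw [h2, map_zpow₀, h3, mul_comm]

lemma exists_ordEq_uniformizer {t : F} (ht : v t = WithZero.exp (-1)) :
    ∃ e : ℕ, 0 < e ∧ OrdEq w e (algebraMap F D t) := by
  have ht0 : t ≠ 0 := by
    rintro rfl
    rw [map_zero] at ht
    exact WithZero.exp_ne_zero ht.symm
  obtain ⟨n, hn⟩ := exists_ordEq (w := w) ((map_ne_zero (algebraMap F D)).2 ht0)
  have h1 : OrdGE w 1 (algebraMap F D t) := by
    rw [ordGE_algebraMap_one_iff (v := v), ht, ← WithZero.exp_zero, WithZero.exp_lt_exp]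
    omega
  have := hn.le h1
  refine ⟨n.toNat, by omega, ?_⟩
  rwa [Int.toNat_of_nonneg (by omega)]

lemma seqComplete_algebraMap {t : F} {e : ℕ} (hv : IsSeqComplete v)
    (ht : v t = WithZero.exp (-1)) (he : OrdEq w e (algebraMap F D t)) (he0 : 0 < e) (d : ℕ → F)
    (hd : ∀ N : ℤ, ∃ M, ∀ n ≥ M, OrdGE w N (algebraMap F D (d (n + 1) - d n))) :
    ∃ f, ∀ N : ℤ, ∃ M, ∀ n ≥ M, OrdGE w N (algebraMap F D (f - d n)) := by
  have hvt : ∀ m : ℤ, v (t ^ m) = WithZero.exp (-m) := fun m => by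
    rw [map_zpow₀, ht, ← WithZero.exp_zsmul]
    simp
  have hiff : ∀ (a : F) (m : ℤ), v a ≤ WithZero.exp (-m) ↔ OrdGE w (e * m) (algebraMap F D a) := by
    intro a m
    rw [← hvt, ← Valuation.HasExtension.val_map_le_iff v w, ordEq_algebraMap ht he (hvt m)]
    rfl
  obtain ⟨f, hf⟩ := hv d (by
    intro γ hγ
    obtain ⟨M, hM⟩ := hd (e * -WithZero.log γ)
    refine ⟨M, fun n hn => ?_⟩
    have := (hiff _ _).2 (hM n hn)
    rwa [neg_neg, WithZero.exp_log hγ] at this)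
  refine ⟨f, fun N => ?_⟩
  obtain ⟨M, hM⟩ := hf (WithZero.exp (-|N|)) WithZero.exp_ne_zero
  refine ⟨M, fun n hn => ((hiff _ _).1 (hM n hn)).mono ?_⟩
  have h1 : (1 : ℤ) ≤ e := by exact_mod_cast he0
  nlinarith [le_abs_self N, abs_nonneg N]

/-- The numerical invariants of a division algebra with commutative residue ring of prime degree
over a complete discretely valued center. -/
theorem isPrimeRamified_of_residueDegree [FiniteDimensional F D] [Algebra.IsCentral F D]
    (hp : p.Prime) (hw : Function.Surjective w)
    (hcomm : ∀ a b : ResidueRing w, a * b = b * a) (hdeg : residueDegree v w = p)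
    (hv : IsSeqComplete v) {t : F} (ht : v t = WithZero.exp (-1)) :
    IsPrimeRamified F w p t ∧ IsSeqComplete w ∧ Module.finrank F D = p ^ 2 := by
  obtain ⟨e, he0, he⟩ := exists_ordEq_uniformizer (w := w) ht
  obtain ⟨x, hx⟩ := exists_isResidueGen hp hcomm hdeg
  obtain ⟨z, hz⟩ := exists_ordEq_of_surjective hw 1
  have B : IsPowBasis F w p e x z t :=
    { ord_z := hz
      ord_t := he
      e_pos := he0
      ord_x := hx.1
      ord_F := fun f hf => by
        obtain ⟨m, hm⟩ := exists_ordEq (w := v) hf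
        exact ⟨m, ordEq_algebraMap ht he hm⟩
      ind := residue_pow_independent hp hcomm hdeg hx
      span := fun y hy => residue_pow_spans hp hcomm hdeg hx hy }
  have hF := seqComplete_algebraMap hv ht he he0
  have hep : e = p := B.ramification_eq hF hp.pos
  subst hep
  refine ⟨⟨hp, hw, he, ⟨x, hx⟩, ?_⟩, B.isSeqComplete hF, by rw [B.finrank_eq hF, sq]⟩
  intro y hy S hyS hFS u hu
  obtain ⟨h, hh, hh'⟩ := residue_pow_spans hp hcomm hdeg hy hu
  exact ⟨_, S.sum_mem fun i _ => S.mul_mem (hFS _ (hh i)) (S.pow_mem hyS _), hh'⟩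

end Assembly

/-! ### Adic completeness of commutative rings of integral elements. -/

section AdicComplete

variable {D : Type*} [DivisionRing D] {w : Valuation D ℤᵐ⁰}

/-- The ring structure of a commutative subring. -/
abbrev subringCommRing (R : Subring D) (hR : ∀ a ∈ R, ∀ b ∈ R, a * b = b * a) : CommRing R :=
  { R.toRing with mul_comm := fun a b => Subtype.ext (hR a a.2 b b.2) }

/-- A commutative ring of integral elements that is closed under limits and under division by
an element `τ` of positive order. -/
structure IsClosedIntegral (w : Valuation D ℤᵐ⁰) (R : Subring D) (τ : R) (e : ℕ) : Prop where
  integral : ∀ r ∈ R, OrdGE w 0 r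
  comm : ∀ a ∈ R, ∀ b ∈ R, a * b = b * a
  closed : ∀ L : D, (∀ n : ℕ, ∃ y ∈ R, OrdGE w n (L - y)) → L ∈ R
  pos : 0 < e
  ord_τ : OrdEq w e (τ : D)
  div : ∀ r ∈ R, ∀ n : ℕ, OrdGE w (e * n) r → ((τ : D) ^ n)⁻¹ * r ∈ R

variable {R : Subring D} {τ : R} {e : ℕ}

lemma IsClosedIntegral.mem_pow_iff (hR : IsClosedIntegral w R τ e) (n : ℕ) (r : R) :
    letI := subringCommRing R hR.comm
    r ∈ Ideal.span {τ} ^ n ↔ OrdGE w (e * n) (r : D) := by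
  let _ := subringCommRing R hR.comm
  have hτn : OrdEq w (e * n) ((τ : D) ^ n) := by
    rw [mul_comm]; exact hR.ord_τ.pow n
  rw [Ideal.span_singleton_pow, Ideal.mem_span_singleton]
  constructor
  · rintro ⟨s, rfl⟩
    exact (hτn.ge.mul (hR.integral s s.2)).mono (by omega)
  · intro h
    refine ⟨⟨_, hR.div r r.2 n h⟩, Subtype.ext ?_⟩
    change (r : D) = (τ : D) ^ n * (((τ : D) ^ n)⁻¹ * r)
    rw [mul_inv_cancel_left₀ hτn.ne_zero]

lemma IsClosedIntegral.isAdicComplete (hR : IsClosedIntegral w R τ e) (hc : IsSeqComplete w) :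
    letI := subringCommRing R hR.comm
    IsAdicComplete (Ideal.span {τ}) R := by
  let _ := subringCommRing R hR.comm
  have hmod : ∀ (n : ℕ) (a b : R), a ≡ b [SMOD (Ideal.span {τ} ^ n • ⊤ : Submodule R R)] ↔
      OrdGE w (e * n) ((a : D) - b) := by
    intro n a b
    rw [SModEq.sub_mem, smul_eq_mul, Ideal.mul_top, hR.mem_pow_iff]
    rfl
  have hen : ∀ n : ℕ, (n : ℤ) ≤ e * n := fun n => by
    have h1 : (1 : ℤ) ≤ e := by exact_mod_cast hR.pos
    nlinarith [(Int.natCast_nonneg n : (0 : ℤ) ≤ n)]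
  have hH : IsHausdorff (Ideal.span {τ}) R := ⟨fun a ha => by
    refine Subtype.ext (eq_zero_of_forall_ordGE (w := w) fun n => ?_)
    have := (hmod n a 0).1 (ha n)
    simp only [ZeroMemClass.coe_zero, sub_zero] at this
    exact this.mono (hen n)⟩
  have hP : IsPrecomplete (Ideal.span {τ}) R := ⟨fun f hf => by
    obtain ⟨L, hL⟩ := hc.exists_limit (fun n => (f n : D)) 0 fun n =>
      (((hmod n _ _).1 (hf n.le_succ)).sub_symm).mono (by have := hen n; omega)
    have hLR : L ∈ R := hR.closed L fun n => ⟨f n, (f n).2, (hL n).mono (by omega)⟩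
    refine ⟨⟨L, hLR⟩, fun n => (hmod n _ _).2 ?_⟩
    -- The limit is known to order N only at index N, and τ^n has order en, so the comparison goes
    -- through index en.
    have h1 := (hmod n _ _).1 (hf (Nat.le_mul_of_pos_left n hR.pos))
    have h2 := (hL (e * n)).mono (m := e * n) (by push_cast; omega)
    simpa using h1.sub h2⟩
  exact { }

end AdicComplete

end ValuedDivision

namespace ValuedDivision

/-! ### Sections of the residue map. -/

section Splitting

open Polynomial IntermediateField

lemma ringHom_ext_of_adjoin_eq_top {E K S : Type*} [Field E] [Field K] [Algebra E K] [Semiring S]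
    {c : K} (htop : E⟮c⟯ = ⊤) {f g : K →+* S} (h : ∀ a, f (algebraMap E K a) = g (algebraMap E K a))
    (hc : f c = g c) : f = g := by
  have h1 : E⟮c⟯ ≤ (f.eqLocusField g).toIntermediateField h := by
    rw [adjoin_simple_le_iff]; exact hc
  rw [htop] at h1
  ext y
  exact h1 (IntermediateField.mem_top (x := y))

/-- An element of prime degree `p` over a field of characteristic `p` has a separable minimal
polynomial unless its `p`-th power lies in the base field. -/
lemma separable_or_pow_mem {E K : Type*} [Field E] [Field K] [Algebra E K] {p : ℕ}
    [hp : Fact p.Prime] [CharP E p] {c : K} (hInt : IsIntegral E c)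
    (hdeg : (minpoly E c).natDegree = p) :
    (minpoly E c).Separable ∨ c ^ p ∈ (algebraMap E K).range := by
  rcases separable_or p (minpoly.irreducible hInt) with h | ⟨-, g, -, hg⟩
  · exact Or.inl h
  · right
    have hg1 : g.natDegree = 1 := by
      rw [← hg, natDegree_expand] at hdeg
      exact Nat.eq_of_mul_eq_mul_right hp.out.pos (by rw [hdeg, one_mul])
    have hroot : aeval (c ^ p) g = 0 := by
      rw [← expand_aeval, hg, minpoly.aeval]
    obtain ⟨a, ha, b, rfl⟩ := natDegree_eq_one.1 hg1
    simp only [map_add, map_mul, aeval_C, aeval_X] at hroot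
    refine ⟨-(a⁻¹ * b), ?_⟩
    have ha' : algebraMap E K a ≠ 0 := (_root_.map_ne_zero _).2 ha
    rw [map_neg, map_mul, map_inv₀]
    field_simp
    linear_combination -hroot

variable {F : Type*} [Field F] {D : Type*} [DivisionRing D] [Algebra F D]
  {v : Valuation F ℤᵐ⁰} {w : Valuation D ℤᵐ⁰} [v.HasExtension w] {p : ℕ} {t : F} {i : ℕ}

section

variable (hp : p.Prime) (hcomm : ∀ a b : ResidueRing w, a * b = b * a)
  (hdeg : residueDegree v w = p)
include hp hdeg

/-- A section over the residue field of `F` extends to the residue ring of `D` as soon as the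
minimal polynomial of a generator has a suitable root. -/
lemma exists_isSection_of_root {x x' : w.integer} (hx : IsResidueGen F w (x : D)) {R : Subring D}
    (hRcomm : ∀ a ∈ R, ∀ b ∈ R, a * b = b * a) (hRint : R ≤ w.integer) (hx' : (x' : D) ∈ R)
    (hxx' : residue w x' = residue w x) (ψ : ResidueRing v →+* R)
    (hψ : ∀ a, residue w (Subring.inclusion hRint (ψ a)) = residueMap v w a)
    (hroot : letI := residueField (residueRing_mul_comm v)
      letI := residueField hcomm
      letI := residueAlgebra v w hcomm
      letI := subringCommRing R hRcomm
      (minpoly (ResidueRing v) (residue w x)).eval₂ ψ ⟨x', hx'⟩ = 0) :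
    ∃ u : ResidueRing w →+* w.integer, IsSection w u ∧
      ∀ a, (u (residueMap v w a) : D) = ψ a := by
  let _ := residueField (residueRing_mul_comm v)
  let _ := residueField hcomm
  let _ := residueAlgebra v w hcomm
  let _ := subringCommRing R hRcomm
  obtain ⟨hInt, htop, -⟩ := residue_adjoin_eq_top hp hcomm hdeg ((isResidueGen_iff v).1 hx)
  obtain ⟨u, hu, hux⟩ := exists_ringHom_extend hInt htop ψ ⟨x', hx'⟩ hroot
  let u' : ResidueRing w →+* w.integer := (Subring.inclusion hRint).comp u
  have hu' : (residue w).comp u' = RingHom.id (ResidueRing w) := by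
    refine ringHom_ext_of_adjoin_eq_top htop (fun a => ?_) ?_
    · change residue w (Subring.inclusion hRint (u (algebraMap _ _ a))) = residueMap v w a
      rw [hu, hψ]
    · change residue w (Subring.inclusion hRint (u (residue w x))) = residue w x
      rw [hux, ← hxx']
      rfl
  refine ⟨u', fun a => RingHom.congr_fun hu' a, fun a => ?_⟩
  exact congrArg Subtype.val (hu a)

end

/-- The integral elements that commute with `x`. -/
def integralCentralizer (w : Valuation D ℤᵐ⁰) (x : D) : Subring D :=
  w.integer ⊓ Subring.centralizer {x}

lemma mem_integralCentralizer {x y : D} :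
    y ∈ integralCentralizer w x ↔ OrdGE w 0 y ∧ ⁅y, x⁆ = 0 := by
  rw [integralCentralizer, Subring.mem_inf, mem_integer_iff_ordGE, Subring.mem_centralizer_iff,
    Ring.lie_def, sub_eq_zero]
  simp [eq_comm]

lemma algebraMap_mem_integralCentralizer {x : D} {f : F} (hf : OrdGE w 0 (algebraMap F D f)) :
    algebraMap F D f ∈ integralCentralizer w x :=
  mem_integralCentralizer.2 ⟨hf, algebraMap_lie f x⟩

/-- The element `t` of the ring of integral elements commuting with `x`. -/
def integralCentralizerUniformizer (H : IsPrimeRamified F w p t) (x : D) :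
    integralCentralizer w x :=
  ⟨algebraMap F D t, algebraMap_mem_integralCentralizer (H.ord_t.ge.mono (by omega))⟩

lemma IsPrimeRamified.isClosedIntegral (H : IsPrimeRamified F w p t) (hi : IsLevel w i) {x : D}
    (hx : IsResidueGen F w x) : IsClosedIntegral w (integralCentralizer w x)
      (integralCentralizerUniformizer H x) p where
  integral r hr := (mem_integralCentralizer.1 hr).1
  comm a ha b hb := sub_eq_zero.1 (H.centralizer_comm hi hx (mem_integralCentralizer.1 ha).2
    (mem_integralCentralizer.1 hb).2)
  closed L hL := by
    have h0 : OrdGE w 0 L := by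
      obtain ⟨y, hy, h⟩ := hL 0
      simpa using h.add (mem_integralCentralizer.1 hy).1
    refine mem_integralCentralizer.2 ⟨h0, eq_zero_of_forall_ordGE (w := w) fun n => ?_⟩
    obtain ⟨y, hy, h⟩ := hL n
    have e : ⁅L, x⁆ = ⁅L - y, x⁆ + ⁅y, x⁆ := by simp only [Ring.lie_def]; noncomm_ring
    rw [e, (mem_integralCentralizer.1 hy).2, add_zero]
    exact (ordGE_lie h hx.1).mono (by omega)
  pos := H.prime.pos
  ord_τ := H.ord_t
  div r hr n h := by
    change (algebraMap F D t ^ n)⁻¹ * r ∈ _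
    have ht := H.ord_t.pow n
    refine mem_integralCentralizer.2 ⟨(ht.inv.ge.mul h).mono (by linarith), ?_⟩
    rw [← map_pow, ← map_inv₀, lie_mul_left, (mem_integralCentralizer.1 hr).2, algebraMap_lie]
    simp

/-- Orders in Z(x) are divisible by p, so positive order means order at least p, the order of t. -/
lemma IsPrimeRamified.mem_ideal_of_ordGE_one (H : IsPrimeRamified F w p t) (hi : IsLevel w i)
    {x : D} (hx : IsResidueGen F w x) {r : integralCentralizer w x} (hr : OrdGE w 1 (r : D)) :
    letI := subringCommRing _ (H.isClosedIntegral hi hx).comm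
    r ∈ Ideal.span {integralCentralizerUniformizer H x} := by
  let _ := subringCommRing _ (H.isClosedIntegral hi hx).comm
  have := ((H.isClosedIntegral hi hx).mem_pow_iff 1 r)
  rw [pow_one] at this
  refine this.2 ?_
  rcases eq_or_ne (r : D) 0 with h0 | h0
  · rw [h0]; exact ordGE_zero _
  · obtain ⟨n, hn⟩ := exists_ordEq (w := w) h0
    obtain ⟨m, rfl⟩ := H.dvd_of_lie_eq_zero hi hx hn (mem_integralCentralizer.1 r.2).2
    have h1 := hn.le hr
    have h2 : (0 : ℤ) < p := by exact_mod_cast H.prime.pos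
    have h3 : 1 ≤ m := by
      by_contra! h
      nlinarith
    exact hn.ge.mono (by push_cast; nlinarith)

variable (w) in
/-- The structure map from the valuation ring of `F` to the integral elements commuting
with `x`. -/
def toIntegralCentralizer (v : Valuation F ℤᵐ⁰) [v.HasExtension w] (x : D) :
    v.integer →+* integralCentralizer w x :=
  ((algebraMap F D).comp v.integer.subtype).codRestrict _ fun a =>
    algebraMap_mem_integralCentralizer ((ordGE_algebraMap_zero_iff (v := v)).2 a.2)

lemma integralCentralizer_le (x : D) : integralCentralizer w x ≤ w.integer := inf_le_left

lemma residue_toIntegralCentralizer (x : D) (a : v.integer) :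
    residue w (Subring.inclusion (integralCentralizer_le x) (toIntegralCentralizer w v x a)) =
      residueMap v w (residue v a) := rfl

lemma charP_integer (v : Valuation F ℤᵐ⁰) [CharP F p] : CharP v.integer p :=
  RingHom.charP v.integer.subtype Subtype.val_injective p

lemma charP_residueRing (hp : p.Prime) (v : Valuation F ℤᵐ⁰) [CharP F p] :
    CharP (ResidueRing v) p := by
  let _ := residueField (residueRing_mul_comm v)
  have := charP_integer (p := p) v
  rw [CharP.charP_iff_prime_eq_zero hp, ← map_natCast (residue v), CharP.cast_eq_zero, map_zero]

section

variable [CharP F p] (hcomm : ∀ a b : ResidueRing w, a * b = b * a)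
  (H : IsPrimeRamified F w p t)
include hcomm H

lemma IsPrimeRamified.not_pow_eq {x : w.integer} (hx : IsResidueGen F w (x : D))
    {c : ResidueRing v} (hc : residue w x ^ p = residueMap v w c) (y : ResidueRing v) :
    y ^ p ≠ c := by
  let _ := residueField (residueRing_mul_comm v)
  let _ := residueField hcomm
  let _ := residueAlgebra v w hcomm
  have : Fact p.Prime := ⟨H.prime⟩
  have := charP_residueRing H.prime v
  have : CharP (ResidueRing w) p :=
    charP_of_injective_algebraMap (algebraMap (ResidueRing v) (ResidueRing w)).injective p
  rintro rfl
  rw [map_pow] at hc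
  exact (isResidueGen_iff v).1 hx ⟨y, (frobenius_inj _ p hc).symm⟩

lemma IsPrimeRamified.minpoly_eq {x : w.integer} (hx : IsResidueGen F w (x : D))
    {c : ResidueRing v} (hc : residue w x ^ p = residueMap v w c) :
    letI := residueField (residueRing_mul_comm v)
    letI := residueField hcomm
    letI := residueAlgebra v w hcomm
    minpoly (ResidueRing v) (residue w x) = X ^ p - C c := by
  let _ := residueField (residueRing_mul_comm v)
  let _ := residueField hcomm
  let _ := residueAlgebra v w hcomm
  have : Fact p.Prime := ⟨H.prime⟩
  have := charP_residueRing H.prime v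
  have : CharP (ResidueRing w) p :=
    charP_of_injective_algebraMap (algebraMap (ResidueRing v) (ResidueRing w)).injective p
  exact minpoly_eq_X_pow_sub_C hc ((isResidueGen_iff v).1 hx)

variable (hdeg : residueDegree v w = p) {s₀ : ResidueRing v →+* v.integer} (hs₀ : IsSection v s₀)
include hdeg hs₀

/-- If a residue generator has a central `p`-th power, then `D` is good splittable. -/
theorem IsPrimeRamified.isGoodSplittable (hv : IsSeqComplete v) (ht : v t = WithZero.exp (-1))
    (hi : IsLevel w i) {x : D} (hx : IsResidueGen F w x) {f : F}
    (hf : x ^ p = algebraMap F D f) : IsGoodSplittable v w := by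
  let _ := residueField (residueRing_mul_comm v)
  have : Fact p.Prime := ⟨H.prime⟩
  have := charP_residueRing H.prime v
  let x₀ : w.integer := ⟨x, mem_integer_iff_ordGE.2 hx.1⟩
  have hfint : v f ≤ 1 := by
    rw [← ordGE_algebraMap_zero_iff (w := w), ← hf]
    exact (hx.1.pow p).mono (by simp)
  let f₀ : v.integer := ⟨f, hfint⟩
  have hc : residue w x₀ ^ p = residueMap v w (residue v f₀) := by
    rw [residueMap_residue, ← map_pow]
    congr 1
    exact Subtype.ext hf
  let τ : v.integer := ⟨t, by
    rw [Valuation.mem_integer_iff, ht, ← WithZero.exp_zero, WithZero.exp_le_exp]; omega⟩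
  have hR : IsClosedIntegral v v.integer τ 1 :=
    { integral := fun r hr => mem_integer_iff_ordGE.1 hr
      comm := fun a _ b _ => mul_comm a b
      closed := fun L hL => by
        obtain ⟨y, hy, h⟩ := hL 0
        rw [mem_integer_iff_ordGE] at hy ⊢
        simpa using h.add hy
      pos := one_pos
      ord_τ := ht
      div := fun r _ n h => by
        rw [mem_integer_iff_ordGE]
        have ht' : OrdEq v 1 (τ : F) := ht
        exact ((ht'.pow n).inv.ge.mul h).mono (by push_cast; linarith) }
  let _ := subringCommRing v.integer hR.comm
  have := hR.isAdicComplete hv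
  have := charP_integer (p := p) v
  have hmem : f₀ - s₀ (residue v f₀) ∈ Ideal.span {τ} := by
    have h1 := (hR.mem_pow_iff 1 (f₀ - s₀ (residue v f₀))).2 (by
      have := residue_eq_iff.1 (hs₀ (residue v f₀)).symm
      simpa using this)
    rwa [pow_one] at h1
  -- The section of F is moved so that the residue of f = x^p is sent to f itself; then x is an
  -- exact root of the lifted minimal polynomial.
  obtain ⟨s, hsc, hs⟩ := exists_ringHom_apply_eq (Ideal.span {τ}) s₀
    (H.not_pow_eq hcomm (x := x₀) hx hc) hmem
  have hsec : IsSection v s := by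
    intro a
    rw [← hs₀ a]
    refine residue_eq_iff.2 ?_
    have h1 := (hR.mem_pow_iff 1 _).1 (by rw [pow_one]; exact hs a)
    rw [hs₀ a]
    simpa using h1
  have hxR : x ∈ integralCentralizer w x :=
    mem_integralCentralizer.2 ⟨hx.1, by rw [Ring.lie_def, sub_self]⟩
  let _ := subringCommRing (integralCentralizer w x) (H.isClosedIntegral hi hx).comm
  obtain ⟨u, hu, hus⟩ := exists_isSection_of_root H.prime hcomm hdeg (x := x₀) (x' := x₀) hx
    (H.isClosedIntegral hi hx).comm (integralCentralizer_le x) hxR rfl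
    ((toIntegralCentralizer w v x).comp s) (by
      intro a
      rw [RingHom.comp_apply, residue_toIntegralCentralizer, hsec]) (by
      rw [H.minpoly_eq hcomm (x := x₀) hx hc, eval₂_sub, eval₂_pow, eval₂_X, eval₂_C,
        RingHom.comp_apply, hsc, sub_eq_zero]
      exact Subtype.ext hf)
  exact ⟨u, s, hu, hsec, hus⟩

/-- A section is built inside the integers of Z(x). In the inseparable case the copy of F̄ is
deformed and may leave F; in the separable case it stays fixed and Hensel's lemma moves x instead.
-/
theorem IsPrimeRamified.isSplittable (hc : IsSeqComplete w) (hi : IsLevel w i) :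
    IsSplittable w := by
  let _ := residueField (residueRing_mul_comm v)
  have : Fact p.Prime := ⟨H.prime⟩
  have := charP_residueRing H.prime v
  obtain ⟨x, hx⟩ := H.exists_gen
  let x₀ : w.integer := ⟨x, mem_integer_iff_ordGE.2 hx.1⟩
  have hR := H.isClosedIntegral hi hx
  have hxR : x ∈ integralCentralizer w x :=
    mem_integralCentralizer.2 ⟨hx.1, by rw [Ring.lie_def, sub_self]⟩
  let X₀ : integralCentralizer w x := ⟨x, hxR⟩
  let _ := subringCommRing (integralCentralizer w x) hR.comm
  let I := Ideal.span {integralCentralizerUniformizer H x}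
  have hI : IsAdicComplete I (integralCentralizer w x) := hR.isAdicComplete hc
  let ι : ResidueRing v →+* integralCentralizer w x := (toIntegralCentralizer w v x).comp s₀
  have hι : ∀ a, residue w (Subring.inclusion (integralCentralizer_le x) (ι a)) =
      residueMap v w a := fun a => by
    rw [RingHom.comp_apply, residue_toIntegralCentralizer, hs₀]
  have hmemI : ∀ r : integralCentralizer w x,
      residue w (Subring.inclusion (integralCentralizer_le x) r) = 0 ↔ r ∈ I := by
    intro r
    rw [residue_eq_zero_iff]
    refine ⟨fun h => H.mem_ideal_of_ordGE_one hi hx h, fun h => ?_⟩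
    have h1 := (hR.mem_pow_iff 1 r).1 (by rw [pow_one]; exact h)
    exact h1.mono (by have := H.prime.one_lt; push_cast; omega)
  by_cases hpow : residue w x₀ ^ p ∈ (residueMap v w).range
  · obtain ⟨c, hcx⟩ := hpow
    have : CharP (integralCentralizer w x) p := charP_of_injective_ringHom (f := ι)
      (RingHom.injective ι) p
    obtain ⟨s, hsc, hs⟩ := exists_ringHom_apply_eq I ι
      (H.not_pow_eq hcomm (x := x₀) hx hcx.symm) (e := X₀ ^ p) (by
        rw [← hmemI, map_sub, map_sub, hι, hcx, sub_eq_zero, map_pow, map_pow]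
        rfl)
    obtain ⟨u, hu, -⟩ := exists_isSection_of_root H.prime hcomm hdeg (x := x₀) (x' := x₀) hx
      hR.comm (integralCentralizer_le x) hxR rfl s (by
        intro a
        rw [← hι a, ← sub_eq_zero, ← map_sub, ← map_sub, hmemI]
        exact hs a) (by
        rw [H.minpoly_eq hcomm (x := x₀) hx hcx.symm, eval₂_sub, eval₂_pow, eval₂_X,
          eval₂_C, hsc, sub_eq_zero])
    exact ⟨u, hu⟩
  · let _ := residueField hcomm
    let _ := residueAlgebra v w hcomm
    obtain ⟨hInt, -, hnat⟩ := residue_adjoin_eq_top H.prime hcomm hdeg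
      ((isResidueGen_iff v (x := x₀)).1 hx)
    have hsep := (separable_or_pow_mem hInt hnat).resolve_right hpow
    let ρ : integralCentralizer w x →+* ResidueRing w :=
      (residue w).comp (Subring.inclusion (integralCentralizer_le x))
    have hρι : ρ.comp ι = algebraMap (ResidueRing v) (ResidueRing w) := RingHom.ext hι
    have heval : ∀ q : (ResidueRing v)[X], ρ ((q.map ι).eval X₀) = aeval (residue w x₀) q := by
      intro q
      rw [eval_map, hom_eval₂, hρι]
      rfl
    have hens : HenselianRing (integralCentralizer w x) I := inferInstance
    obtain ⟨y, hy, hyx⟩ := hens.is_henselian ((minpoly (ResidueRing v) (residue w x₀)).map ι)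
      ((minpoly.monic hInt).map ι) X₀ (by
        rw [← hmemI]
        exact (heval _).trans (minpoly.aeval _ _)) (by
        rw [derivative_map]
        set r := ((derivative (minpoly (ResidueRing v) (residue w x₀))).map ι).eval X₀ with hr
        have h1 : ρ r ≠ 0 := by
          rw [hr, heval]
          exact hsep.aeval_derivative_ne_zero (minpoly.aeval _ _)
        have h2 : OrdEq w 0 (r : D) := (ordEq_or_ordGE (hR.integral r r.2)).resolve_right
          fun h => h1 (residue_eq_zero_iff.2 h)
        have h3 : (r : D)⁻¹ ∈ integralCentralizer w x := by
          refine mem_integralCentralizer.2 ⟨by simpa using h2.inv.ge, ?_⟩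
          rw [lie_inv_left h2.ne_zero, (mem_integralCentralizer.1 r.2).2]
          simp
        refine IsUnit.map _ (IsUnit.of_mul_eq_one ⟨_, h3⟩ (Subtype.ext ?_))
        exact mul_inv_cancel₀ h2.ne_zero)
    obtain ⟨u, hu, -⟩ := exists_isSection_of_root H.prime hcomm hdeg (x := x₀)
      (x' := Subring.inclusion (integralCentralizer_le x) y) hx
      hR.comm (integralCentralizer_le x) y.2 (by
        have := (hmemI _).2 hyx
        rw [map_sub, map_sub, sub_eq_zero] at this
        exact this) ι hι (by
        rw [IsRoot, eval_map] at hy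
        exact hy)
    exact ⟨u, hu⟩

end

end Splitting

end ValuedDivision

namespace ValuedDivision

universe u

/-! ### Local height, parameters and unramified maximal subfields. -/

section Structure

variable {F : Type*} [Field F] {D : Type u} [DivisionRing D] [Algebra F D]
  {v : Valuation F ℤᵐ⁰} {w : Valuation D ℤᵐ⁰} {p : ℕ} {t : F} {i : ℕ}

/-- Some power of z has order 1, so the order of z divides 1. -/
lemma IsParameter.exists_ordEq_not_dvd (hp : p.Prime) (hw : Function.Surjective w) {z : D}
    (hz : IsParameter w z) : ∃ n : ℤ, OrdEq w n z ∧ ¬ (p : ℤ) ∣ n := by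
  obtain ⟨n, hn⟩ := exists_ordEq (w := w) hz.1
  obtain ⟨y, hy⟩ := exists_ordEq_of_surjective hw 1
  obtain ⟨m, hm⟩ := hz.2 y hy.ne_zero
  rw [← map_zpow₀] at hm
  have h1 : OrdEq w 1 (z ^ m) := hm.symm.trans hy
  have h2 := h1.unique (hn.zpow m)
  refine ⟨n, hn, fun h => hp.one_lt.ne' ?_⟩
  have h3 : (p : ℤ) ∣ 1 := h2 ▸ h.mul_left m
  exact_mod_cast Int.eq_one_of_dvd_one (by positivity) h3

lemma OrdEq.isParameter {z : D} (hz : OrdEq w 1 z) : IsParameter w z := by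
  refine ⟨hz.ne_zero, fun y hy => ?_⟩
  obtain ⟨n, hn⟩ := exists_ordEq (w := w) hy
  refine ⟨n, ?_⟩
  have h := hz.zpow n
  rw [mul_one] at h
  rw [← map_zpow₀]
  exact hn.trans h.symm

/-- The local height equals the level, for every section and every parameter. -/
theorem IsPrimeRamified.isLocalHeight (H : IsPrimeRamified F w p t) (hi : IsLevel w i)
    {u : ResidueRing w →+* w.integer} (hu : IsSection w u) {z : D} (hz : IsParameter w z) :
    IsLocalHeight w u z i := by
  obtain ⟨n, hn, hpn⟩ := hz.exists_ordEq_not_dvd H.prime H.surj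
  have key : ∀ a : D, z * a * z⁻¹ - a = ⁅z, a⁆ * z⁻¹ := fun a => by
    rw [Ring.lie_def, sub_mul, mul_inv_cancel_right₀ hz.1]
  constructor
  · obtain ⟨x, hx⟩ := H.exists_gen
    let x₀ : w.integer := ⟨x, mem_integer_iff_ordGE.2 hx.1⟩
    refine ⟨residue w x₀, ?_⟩
    have hux : IsResidueGen F w (u (residue w x₀) : D) :=
      hx.of_sub (residue_eq_iff.1 (hu (residue w x₀)))
    have h := (H.ordEq_lie hi hux hn hpn).mul hn.inv
    rw [← key, add_right_comm, add_neg_cancel, zero_add] at h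
    exact h
  · rintro _ ⟨a, rfl⟩
    have h := (hi.le hn.ge (mem_integer_iff_ordGE.1 (u a).2)).mul hn.inv.ge
    rw [← key] at h
    exact h.mono (m := (i : ℤ)) (by omega)

lemma IsLocalHeight.unique {u : ResidueRing w →+* w.integer} {z : D} {i j : ℕ}
    (hi : IsLocalHeight w u z i) (hj : IsLocalHeight w u z j) : i = j := by
  have h := WithZero.exp_injective (IsGreatest.unique hi hj)
  omega

section Normalizer

variable (H : IsPrimeRamified F w p t) (hc : IsSeqComplete w) (hi : IsLevel w i) (hpi : p ∣ i)
include H hc hi hpi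

/-- If `p` divides the level, then the centralizer of a residue generator is normalized by an
element of order one. -/
lemma IsPrimeRamified.exists_normalizes_centralizer {x : D} (hx : IsResidueGen F w x) :
    ∃ z, OrdEq w 1 z ∧ ∀ y, ⁅y, x⁆ = 0 → ⁅z * y * z⁻¹, x⁆ = 0 := by
  obtain ⟨z, l, hz, hl, hzl⟩ := H.exists_normalizer hc hi hpi hx
  have hl' : l = z * x * z⁻¹ := by rw [hzl, mul_inv_cancel_right₀ hz.ne_zero]
  refine ⟨z, hz, fun y hy => ?_⟩
  -- Both zyz⁻¹ and x commute with l = zxz⁻¹, and l is again a residue generator, so its centralizer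
  -- is commutative.
  refine H.centralizer_comm hi (x := l) (hl' ▸ hx.conj hz) ?_ ?_
  · rw [Ring.lie_def, sub_eq_zero] at hy ⊢
    have e : ∀ a b : D, z * a * z⁻¹ * (z * b * z⁻¹) = z * (a * b) * z⁻¹ := fun a b => by
      simp only [mul_assoc, inv_mul_cancel_left₀ hz.ne_zero]
    rw [hl', e, e, hy]
  · rw [Ring.lie_def, sub_eq_zero] at hl ⊢
    exact hl.symm

variable [FiniteDimensional F D] [Algebra.IsCentral F D] (hD : Module.finrank F D = p ^ 2)
include hD

/-- If `p` divides the level, then the centralizer of a residue generator is cyclic over `F`. -/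
theorem IsPrimeRamified.cyclic_centralizer {L : Type u} [Field L] [Algebra F L] (f : L →ₐ[F] D)
    {x : D} (hx : IsResidueGen F w x) (hf : ∀ y, y ∈ f.range ↔ ⁅y, x⁆ = 0) :
    IsCyclicGalois F L ∧ IsCyclicAlgebra F D p ∧
      ∃ z, OrdEq w 1 z ∧ z ^ p ∈ Subring.center D := by
  obtain ⟨z, hz, hzx⟩ := H.exists_normalizes_centralizer hc hi hpi hx
  obtain ⟨l₀, hl₀⟩ := (hf x).2 (by rw [Ring.lie_def, sub_self])
  have hp1 : ¬ (p : ℤ) ∣ 1 := fun h => H.prime.one_lt.ne'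
    (by exact_mod_cast Int.eq_one_of_dvd_one (by positivity) h)
  obtain ⟨h1, h2, h3⟩ := cyclic_of_normalizes H.prime hD f z (fun l => by
    obtain ⟨l', hl'⟩ := (hf _).2 (hzx (f l) ((hf _).1 ⟨l, rfl⟩))
    refine ⟨l', ?_⟩
    rw [show f l' = _ from hl', inv_mul_cancel_right₀ hz.ne_zero]) l₀ (by
    rw [show f l₀ = x from hl₀]
    exact fun h => (H.ordEq_lie hi hx hz hp1).ne_zero (sub_eq_zero.2 h))
  exact ⟨h1, h2, z, hz, h3⟩

theorem IsPrimeRamified.isCyclicAlgebra_of_dvd :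
    IsCyclicAlgebra F D p ∧ ∃ z, OrdEq w 1 z ∧ z ^ p ∈ Subring.center D := by
  obtain ⟨x, hx⟩ := H.exists_gen
  have hmem : ∀ y, y ∈ Subalgebra.centralizer F {x} ↔ ⁅y, x⁆ = 0 := fun y => by
    rw [Subalgebra.mem_centralizer_iff, Ring.lie_def, sub_eq_zero]
    simp [eq_comm]
  let _ := subalgebraField (Subalgebra.centralizer F {x}) fun a ha b hb =>
    sub_eq_zero.1 (H.centralizer_comm hi hx ((hmem a).1 ha) ((hmem b).1 hb))
  refine (H.cyclic_centralizer hc hi hpi hD (Subalgebra.centralizer F {x}).val hx fun y => ?_).2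
  rw [Subalgebra.range_val, hmem]

omit hc hi hpi hD [Algebra.IsCentral F D] in
/-- An unramified maximal subfield contains a residue generator. -/
lemma IsPrimeRamified.exists_gen_mem [v.HasExtension w] {L : Type u} [Field L] [Algebra F L]
    (f : L →ₐ[F] D) (hmax : IsMaximalSubfield F f) (hunr : IsUnramifiedSubfield F v w f) :
    ∃ l, IsResidueGen F w (f l) := by
  by_contra! hno
  have hcomm := residueRing_mul_comm (w.comap (f : L →+* D))
  let _ := residueField (residueRing_mul_comm v)
  let _ := residueField hcomm
  let _ := residueAlgebra v (w.comap (f : L →+* D)) hcomm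
  have hsurj : ∀ a, a ∈ (residueMap v (w.comap (f : L →+* D))).range := by
    intro a
    obtain ⟨l, rfl⟩ := Ideal.Quotient.mk_surjective a
    by_contra h
    obtain ⟨h1, h2⟩ := (isResidueGen_iff v).2 h
    refine hno l ⟨h1, fun g hg => h2 g ?_⟩
    rw [← f.commutes, ← map_sub] at hg
    exact hg
  -- Without a residue generator in L the residue extension is trivial, so L = F; but F[x] is
  -- commutative and strictly larger.
  have h1 : residueDegree v (w.comap (f : L →+* D)) ≤ 1 := by
    rw [← finrank_residueAlgebra hcomm]
    refine finrank_le_one 1 fun a => ?_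
    obtain ⟨c, hc⟩ := hsurj a
    exact ⟨c, by rw [Algebra.smul_def, mul_one]; exact hc⟩
  have hfin := finiteDimensional_of_algHom f
  have h2 : Module.finrank F L = 1 := by
    have : 0 < Module.finrank F L := Module.finrank_pos
    rw [IsUnramifiedSubfield] at hunr
    omega
  obtain ⟨x, hx⟩ := H.exists_gen
  have hbot := Subalgebra.bot_eq_top_of_finrank_eq_one h2
  have hL : ∀ l : L, ∃ c : F, algebraMap F L c = l := fun l =>
    Algebra.mem_bot.1 (hbot ▸ Algebra.mem_top)
  have hS := hmax (Algebra.adjoin F {x}) (adjoin_singleton_comm x) (by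
    rintro _ ⟨l, rfl⟩
    obtain ⟨c, rfl⟩ := hL l
    exact (f.commutes c).symm ▸ Subalgebra.algebraMap_mem _ c)
  have hxf : x ∈ f.range := hS ▸ Algebra.self_mem_adjoin_singleton F x
  obtain ⟨l, hl⟩ := hxf
  obtain ⟨c, rfl⟩ := hL l
  refine hx.2 c ?_
  rw [← hl, show f.toRingHom (algebraMap F L c) = algebraMap F D c from f.commutes c, sub_self]
  exact ordGE_zero _

/-- L contains a residue generator, whose centralizer is commutative and contains L, hence equals L
by maximality. -/
theorem IsPrimeRamified.isCyclicGalois [v.HasExtension w] {L : Type u} [Field L] [Algebra F L]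
    (f : L →ₐ[F] D) (hmax : IsMaximalSubfield F f) (hunr : IsUnramifiedSubfield F v w f) :
    IsCyclicGalois F L := by
  obtain ⟨l, hl⟩ := H.exists_gen_mem f hmax hunr
  have hmem : ∀ y, y ∈ Subalgebra.centralizer F {f l} ↔ ⁅y, f l⁆ = 0 := fun y => by
    rw [Subalgebra.mem_centralizer_iff, Ring.lie_def, sub_eq_zero]
    simp [eq_comm]
  have hS := hmax (Subalgebra.centralizer F {f l}) (fun a ha b hb =>
    sub_eq_zero.1 (H.centralizer_comm hi hl ((hmem a).1 ha) ((hmem b).1 hb))) (by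
      rintro _ ⟨l', rfl⟩
      refine (hmem _).2 ?_
      rw [Ring.lie_def, sub_eq_zero]
      change f l' * f l = f l * f l'
      rw [← map_mul, ← map_mul, mul_comm])
  exact (H.cyclic_centralizer hc hi hpi hD f hl fun y => by rw [← hS, hmem]).1

end Normalizer

end Structure

/-! ### Completeness and coefficient field of Laurent series. -/

section Laurent

variable (k : Type*) [Field k]

lemma isSeqComplete_laurentSeries : IsSeqComplete (Valued.v : Valuation k⸨X⸩ ℤᵐ⁰) := by
  intro d hd
  choose M hM using fun m : ℤ => hd (WithZero.exp (-m)) WithZero.exp_ne_zero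
  have hstab : ∀ (m : ℤ) n, M m ≤ n → ∀ j < m, (d n).coeff j = (d (M m)).coeff j := by
    intro m n hn j hj
    induction n, hn using Nat.le_induction with
    | base => rfl
    | succ n hn ih =>
      rw [← ih]
      exact LaurentSeries.eq_coeff_of_valuation_sub_lt k (hM m n hn) hj
  have hstab' : ∀ m m' j : ℤ, j < m → j < m' → (d (M m)).coeff j = (d (M m')).coeff j := by
    intro m m' j hj hj'
    rw [← hstab m _ (le_max_left _ (M m')) j hj, hstab m' _ (le_max_right _ _) j hj']
  -- The term `d (M 0)` already has the right coefficients in negative degrees; the power series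
  -- corrects degree n to its stable value, reached at `M (n + 1)`.
  let x : k⸨X⸩ := d (M 0) +
    ((PowerSeries.mk fun n : ℕ => (d (M (n + 1)) - d (M 0)).coeff n : PowerSeries k) : k⸨X⸩)
  have hx : ∀ m j : ℤ, j < m → x.coeff j = (d (M m)).coeff j := by
    intro m j hj
    rw [HahnSeries.coeff_add, PowerSeries.coeff_coe]
    split_ifs with h
    · rw [add_zero]
      exact hstab' 0 m j h hj
    · obtain ⟨n, rfl⟩ := Int.eq_ofNat_of_zero_le (not_lt.1 h)
      rw [PowerSeries.coeff_mk, Int.natAbs_natCast, HahnSeries.coeff_sub, add_sub_cancel]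
      exact hstab' _ m _ (lt_add_one _) hj
  refine ⟨x, fun γ hγ => ⟨M (-WithZero.log γ), fun n hn => ?_⟩⟩
  rw [LaurentSeries.valuation_le_iff_coeff_lt_log_eq_zero k hγ]
  intro j hj
  rw [HahnSeries.coeff_sub, hx _ j hj, hstab _ n hn j hj, sub_self]

/-- The constants, as elements of the valuation ring of `k⸨X⸩`. -/
noncomputable def laurentConst : k →+* (Valued.v : Valuation k⸨X⸩ ℤᵐ⁰).integer :=
  (HahnSeries.C : k →+* k⸨X⸩).codRestrict _ fun a => by
    rw [Valuation.mem_integer_iff, ← WithZero.exp_zero, ← neg_zero,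
      LaurentSeries.valuation_le_iff_coeff_lt_eq_zero]
    intro n hn
    exact HahnSeries.coeff_single_of_ne hn.ne

lemma exists_isSection_laurentSeries :
    ∃ s, IsSection (Valued.v : Valuation k⸨X⸩ ℤᵐ⁰) s := by
  let v : Valuation k⸨X⸩ ℤᵐ⁰ := Valued.v
  let _ := residueField (residueRing_mul_comm v)
  let g : k →+* ResidueRing v := (residue v).comp (laurentConst k)
  have hg : Function.Surjective g := by
    intro a
    obtain ⟨f, rfl⟩ := Ideal.Quotient.mk_surjective a
    refine ⟨(f : k⸨X⸩).coeff 0, residue_eq_iff.2 ?_⟩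
    refine (LaurentSeries.valuation_le_iff_coeff_lt_eq_zero k (D := 1)).2 fun n hn => ?_
    change (HahnSeries.single 0 ((f : k⸨X⸩).coeff 0) - (f : k⸨X⸩)).coeff n = 0
    rw [HahnSeries.coeff_sub, sub_eq_zero]
    rcases (show n ≤ 0 by omega).lt_or_eq with h | rfl
    · rw [HahnSeries.coeff_single_of_ne h.ne]
      refine (LaurentSeries.coeff_zero_of_lt_valuation k (D := 0) ?_ h).symm
      rw [neg_zero, WithZero.exp_zero]
      exact f.2
    · exact HahnSeries.coeff_single_same _ _
  let e : k ≃+* ResidueRing v := RingEquiv.ofBijective g ⟨g.injective, hg⟩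
  exact ⟨(laurentConst k).comp e.symm.toRingHom, fun a => e.apply_symm_apply a⟩

end Laurent

lemma exists_mul_ne_mul {F D : Type*} [Field F] [DivisionRing D] [Algebra F D]
    [Algebra.IsCentral F D] (h : Module.finrank F D ≠ 1) : ∃ a b : D, a * b ≠ b * a := by
  by_contra! hab
  refine h ?_
  rw [← Subalgebra.bot_eq_top_iff_finrank_eq_one, ← Algebra.IsCentral.center_eq_bot F D,
    eq_top_iff]
  exact fun a _ => Subalgebra.mem_center_iff.2 fun b => hab b a

end ValuedDivision

/-! ### The main theorem. -/

open ValuedDivision in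
theorem mainTheorem6 {k : Type*} [Field k] {D : Type*} [DivisionRing D] [Algebra k⸨X⸩ D]
    [FiniteDimensional k⸨X⸩ D] [Algebra.IsCentral k⸨X⸩ D]
    (p : ℕ) (hp : p.Prime) [CharP D p]
    -- the extension to `D` of the valuation of `k⸨X⸩`, normalized to have value group `ℤ`
    (w : Valuation D ℤᵐ⁰) [(Valued.v : Valuation k⸨X⸩ ℤᵐ⁰).HasExtension w]
    (hw : Function.Surjective w)
    (hcomm : Subring.center (ResidueRing w) = ⊤)
    (hdeg : residueDegree (Valued.v : Valuation k⸨X⸩ ℤᵐ⁰) w = p) :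
    IsSplittable w ∧
    (∃ i : ℕ, ∀ (u : ResidueRing w →+* w.integer) (z : D),
      IsSection w u → IsParameter w z → ConjTrivial w z → IsLocalHeight w u z i) ∧
    (∀ (u : ResidueRing w →+* w.integer) (z : D) (i : ℕ),
      IsSection w u → IsParameter w z → ConjTrivial w z → IsLocalHeight w u z i →
        (i.Coprime p → IsGoodSplittable (Valued.v : Valuation k⸨X⸩ ℤᵐ⁰) w) ∧
        (p ∣ i →
          (∃ z' : D, IsParameter w z' ∧ z' ^ p ∈ Subring.center D) ∧
          ∀ (L : Type _) [Field L] [Algebra k⸨X⸩ L] (f : L →ₐ[k⸨X⸩] D),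
            IsMaximalSubfield k⸨X⸩ f → IsUnramifiedSubfield k⸨X⸩ Valued.v w f →
              IsCyclicGalois k⸨X⸩ L)) ∧
    IsCyclicAlgebra k⸨X⸩ D p := by
  have hcomm' : ∀ a b : ResidueRing w, a * b = b * a := fun a b =>
    (Subring.mem_center_iff.1 (hcomm ▸ Subring.mem_top b) a)
  have : Fact p.Prime := ⟨hp⟩
  have : CharP k⸨X⸩ p := ((algebraMap k⸨X⸩ D).charP_iff_charP p).2 inferInstance
  have hv := isSeqComplete_laurentSeries k
  have ht := LaurentSeries.valuation_single_zpow k 1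
  obtain ⟨s₀, hs₀⟩ := exists_isSection_laurentSeries k
  obtain ⟨H, hc, hD⟩ := isPrimeRamified_of_residueDegree hp hw hcomm' hdeg hv ht
  obtain ⟨a, b, hab⟩ := exists_mul_ne_mul (F := k⸨X⸩) (D := D) (by
    rw [hD]
    exact (Nat.one_lt_pow two_ne_zero hp.one_lt).ne')
  obtain ⟨i, hi⟩ := exists_isLevel (w := w) hab
  refine ⟨H.isSplittable hcomm' hdeg hs₀ hc hi,
    ⟨i, fun u z hu hz _ => H.isLocalHeight hi hu hz⟩, fun u z j hu hz _ hj => ?_, ?_⟩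
  · obtain rfl := (H.isLocalHeight hi hu hz).unique hj
    refine ⟨fun hip => ?_, fun hpi => ⟨?_, fun L _ _ f hmax hunr =>
      H.isCyclicGalois hc hi hpi hD f hmax hunr⟩⟩
    · obtain ⟨x, hx, hxp⟩ := H.exists_pow_central hc hi
        fun h => hp.one_lt.ne' (Nat.eq_one_of_dvd_coprimes hip h dvd_rfl)
      obtain ⟨f, hf⟩ := (Algebra.IsCentral.mem_center_iff k⸨X⸩).1
        (Subalgebra.mem_center_iff.2 fun d => (sub_eq_zero.1 (hxp d)).symm)
      exact H.isGoodSplittable hcomm' hdeg hs₀ hv ht hi hx hf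
    · obtain ⟨-, z', hz', hz'p⟩ := H.isCyclicAlgebra_of_dvd hc hi hpi hD
      exact ⟨z', hz'.isParameter, hz'p⟩
  -- The split is on the level rather than on a local height, so it also covers level 0, where no
  -- parameter acts trivially on the residue field.
  · by_cases hpi : p ∣ i
    · exact (H.isCyclicAlgebra_of_dvd hc hi hpi hD).1
    · obtain ⟨x, hx, hxp⟩ := H.exists_pow_central hc hi hpi
      obtain ⟨z, hz⟩ := exists_ordEq_of_surjective hw 1
      refine isCyclicAlgebra_of_pow_central hD (x := x) (d := z) (fun h => ?_) hxp
      have h1 := H.ordEq_lie_uniformizer hi hx hz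
      exact h1.ne_zero (sub_eq_zero.2 (sub_eq_zero.1 h).symm)
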